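/- Conventions. $G$ is a discrete group with left regular representation $\lambda$ on $\ell^2(G)$, with canonical basis $(e_g)_{g\in G}$; $C^*(G)$ (generated by the universal unitaries $u_g$) and $C^*_\lambda(G)$ are its full and reduced C*-algebras, with comultiplications $\Delta(u_g)=u_g\otimes u_g$ and $\Delta_\lambda(\lambda_g)=\lambda_g\otimes\lambda_g$, and $\lambda\colon C^*(G)\to C^*_\lambda(G)$ also denotes the quotient map $u_g\mapsto\lambda_g$. All tensor products of operator algebras are minimal (spatial), $\mathbb K=\mathbb K(\ell^2(G))$, and $M_f$ is multiplication by $f$. An operator algebra is a norm-closed (not necessarily unital) subalgebra $\mathcal A\subseteq\mathbb B(\mathcal H)$ for a Hilbert space $\mathcal H$. A coaction of $G$ on $\mathcal A$ is a completely contractive homomorphism $\delta\colon\mathcal A\to\mathcal A\otimes C^*(G)$ with $(\delta\otimes\mathrm{id})\circ\delta=(\mathrm{id}\otimes\Delta)\circ\delta$ and $\overline{\mathrm{span}}\,\delta(\mathcal A)(I\otimes C^*(G))=\mathcal A\otimes C^*(G)$; it is normal if $\delta_\lambda:=(\mathrm{id}\otimes\lambda)\circ\delta\colon\mathcal A\to\mathcal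 A\otimes C^*_\lambda(G)\subseteq\mathbb B(\mathcal H\otimes\ell^2(G))$ is completely isometric. A reduced coaction is a completely isometric homomorphism $\varepsilon\colon\mathcal A\to\mathcal A\otimes C^*_\lambda(G)$ satisfying the same two conditions with $C^*_\lambda(G),\Delta_\lambda$ in place of $C^*(G),\Delta$. For a coaction $\delta$ on $\mathcal A\subseteq\mathbb B(\mathcal H)$ put, on $\mathcal H\otimes\ell^2(G)\otimes\ell^2(G)$, $k_{\mathcal A}(a)=\delta_\lambda(a)\otimes I$, $k_{c_0(G)}(f)=I\otimes D_f$ with $D_f(e_g\otimes e_h)=f(gh^{-1})\,e_g\otimes e_h$, and $k_G(g)=I\otimes I\otimes\lambda_g$. The reduced double crossed product $\mathcal A\rtimes_\delta G\rtimes^r_{\hat\delta}G$ is the norm-closed algebra generated by the products $k_{\mathcal A}(a)k_{c_0(G)}(f)k_G(g)$ with $a\in\mathcal A$, $f\in c_0(G)$, $g\in G$. Let $U,S$ be the unitaries on $\ell^2(G)\otimes\ell^2(G)$ with $U(e_g\otimes e_h)=e_g\otimes e_{gh}$ and $S(e_g\otimes e_h)=e_g\otimes e_{h^{-1}}$. Theorem.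 Let $\mathcal A\subseteq\mathbb B(\mathcal H)$ be an operator algebra, $G$ a discrete group, and $\delta$ a normal coaction of $G$ on $\mathcal A$. Let $V=I_{\mathcal H}\otimes US$. Then $\Psi(x)=VxV^*$ defines a completely isometric isomorphism $$\Psi\colon\mathcal A\rtimes_\delta G\rtimes^r_{\hat\delta}G\to\delta_\lambda(\mathcal A)\otimes\mathbb K .$$ The formula $$\hat{\hat\delta}(x)=(I_{\mathcal H}\otimes I\otimes U)(x\otimes I)(I_{\mathcal H}\otimes I\otimes U^*)$$ defines a reduced coaction of $G$ on $\mathcal A\rtimes_\delta G\rtimes^r_{\hat\delta}G$, the formula $$\tilde\delta(x)=(I_{\mathcal H}\otimes I\otimes U^*)\big[(\delta_\lambda\otimes\Sigma)\circ(\delta_\lambda\otimes\mathrm{id}_{\mathbb K})\circ(\delta_\lambda^{-1}\otimes\mathrm{id}_{\mathbb K})(x)\big](I_{\mathcal H}\otimes I\otimes U),$$ where $\Sigma\colon C^*_\lambda(G)\otimes\mathbb K\to\mathbb K\otimes C^*_\lambda(G)$ is the flip, defines a reduced coaction of $G$ on $\delta_\lambda(\mathcal A)\otimes\mathbb K$,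 and $\Psi$ conjugates the first to the second: $\tilde\delta\circ\Psi=(\Psi\otimes\mathrm{id}_{C^*_\lambda(G)})\circ\hat{\hat\delta}$. -/

import Mathlib

open scoped TensorProduct ENNReal Topology
open UniformSpace

noncomputable section

namespace Katayama

/-! ## Hilbert spaces and operators -/

/-- The Hilbert space `ℓ²(ι)`. -/
abbrev L2 (ι : Type*) := lp (fun _ : ι => ℂ) 2

/-- The algebra `𝔹(X)` of bounded operators. -/
abbrev Bd (X : Type*) [NormedAddCommGroup X] [InnerProductSpace ℂ X] := X →L[ℂ] X

/-- The Hilbert space tensor product of `X` and `Y`: the completion of the algebraic tensor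
product for the inner product `⟪x ⊗ y, x' ⊗ y'⟫ = ⟪x, x'⟫ ⟪y, y'⟫`. -/
def HT (X Y : Type*) [NormedAddCommGroup X] [InnerProductSpace ℂ X]
    [NormedAddCommGroup Y] [InnerProductSpace ℂ Y] := Completion (X ⊗[ℂ] Y)

section Tensor

variable {X X' Y Y' Z : Type*}
  [NormedAddCommGroup X] [InnerProductSpace ℂ X] [NormedAddCommGroup X'] [InnerProductSpace ℂ X']
  [NormedAddCommGroup Y] [InnerProductSpace ℂ Y] [NormedAddCommGroup Y'] [InnerProductSpace ℂ Y']
  [NormedAddCommGroup Z] [InnerProductSpace ℂ Z]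

instance : NormedAddCommGroup (HT X Y) :=
  inferInstanceAs (NormedAddCommGroup (Completion (X ⊗[ℂ] Y)))

instance : InnerProductSpace ℂ (HT X Y) :=
  inferInstanceAs (InnerProductSpace ℂ (Completion (X ⊗[ℂ] Y)))

instance : CompleteSpace (HT X Y) := inferInstanceAs (CompleteSpace (Completion (X ⊗[ℂ] Y)))

variable (X Y) in
/-- The isometric embedding of the algebraic tensor product. -/
def emb : X ⊗[ℂ] Y →ₗᵢ[ℂ] HT X Y := Completion.toComplₗᵢ (𝕜 := ℂ) (E := X ⊗[ℂ] Y)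

theorem denseRange_emb : DenseRange (emb X Y) := Completion.denseRange_coe (α := X ⊗[ℂ] Y)

/-- The elementary tensor `x ⊗ y` in the Hilbert space tensor product. -/
def vec (x : X) (y : Y) : HT X Y := emb X Y (x ⊗ₜ[ℂ] y)

/-- The bounded operator `a ⊗ b`, with `(a ⊗ b)(x ⊗ y) = a x ⊗ b y`. -/
def op (a : X →L[ℂ] X') (b : Y →L[ℂ] Y') : HT X Y →L[ℂ] HT X' Y' :=
  (TensorProduct.mapL a b).completion

theorem op_emb (a : X →L[ℂ] X') (b : Y →L[ℂ] Y') (t : X ⊗[ℂ] Y) :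
    op a b (emb X Y t) = emb X' Y' (TensorProduct.mapL a b t) :=
  ContinuousLinearMap.completion_apply_coe _ _

@[simp] theorem op_vec (a : X →L[ℂ] X') (b : Y →L[ℂ] Y') (x : X) (y : Y) :
    op a b (vec x y) = vec (a x) (b y) := by
  simp [vec, op_emb]

theorem dense_span_vec :
    Dense (Submodule.span ℂ {z : HT X Y | ∃ x y, z = vec x y} : Set (HT X Y)) := by
  refine (denseRange_emb (X := X) (Y := Y)).mono ?_
  rintro _ ⟨t, rfl⟩
  induction t with
  | zero => simp
  | tmul x y => exact Submodule.subset_span ⟨x, y, rfl⟩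
  | add s t hs ht => rw [map_add]; exact add_mem hs ht

theorem clm_ext_vec {E : Type*} [NormedAddCommGroup E] [NormedSpace ℂ E] {S T : HT X Y →L[ℂ] E}
    (h : ∀ x y, S (vec x y) = T (vec x y)) : S = T :=
  ContinuousLinearMap.ext_on dense_span_vec (by rintro _ ⟨x, y, rfl⟩; exact h x y)

theorem op_comp {X'' Y'' : Type*} [NormedAddCommGroup X''] [InnerProductSpace ℂ X'']
    [NormedAddCommGroup Y''] [InnerProductSpace ℂ Y''] (a' : X' →L[ℂ] X'') (b' : Y' →L[ℂ] Y'')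
    (a : X →L[ℂ] X') (b : Y →L[ℂ] Y') : op a' b' ∘L op a b = op (a' ∘L a) (b' ∘L b) :=
  clm_ext_vec fun x y => by simp

theorem inner_vec (x x' : X) (y y' : Y) :
    inner ℂ (vec x y) (vec x' y') = inner ℂ x x' * inner ℂ y y' := by
  simp [vec, LinearIsometry.inner_map_map]

/-- `(x, y) ↦ x ⊗ y` as a bounded bilinear map. -/
def vecL : X →L[ℂ] Y →L[ℂ] HT X Y :=
  (ContinuousLinearMap.compL ℂ Y (X ⊗[ℂ] Y) (HT X Y) (emb X Y).toContinuousLinearMap) ∘L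
    TensorProduct.mkL ℂ X Y

theorem vec_mem_closure_span {s : Set X} {t : Set Y} (hs : Dense (Submodule.span ℂ s : Set X))
    (ht : Dense (Submodule.span ℂ t : Set Y)) (P : Submodule ℂ (HT X Y))
    (hP : IsClosed (P : Set (HT X Y))) (h : ∀ x ∈ s, ∀ y ∈ t, vec x y ∈ P) : P = ⊤ := by
  have h1 : ∀ x ∈ s, ∀ y, vec x y ∈ P := by
    intro x hx y
    have hc : IsClosed ((P.comap (vecL (X := X) (Y := Y) x).toLinearMap : Submodule ℂ Y) : Set Y) :=
      hP.preimage (vecL (X := X) (Y := Y) x).continuous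
    have hle : Submodule.span ℂ t ≤ P.comap (vecL (X := X) (Y := Y) x).toLinearMap :=
      Submodule.span_le.2 fun y hy => h x hx y hy
    exact hc.closure_subset_iff.2 hle (ht y)
  have h2 : ∀ x y, vec x y ∈ P := by
    intro x y
    have hc : IsClosed ((P.comap ((vecL (X := X) (Y := Y)).flip y).toLinearMap : Submodule ℂ X)
        : Set X) := hP.preimage ((vecL (X := X) (Y := Y)).flip y).continuous
    have hle : Submodule.span ℂ s ≤ P.comap ((vecL (X := X) (Y := Y)).flip y).toLinearMap :=
      Submodule.span_le.2 fun x hx => h1 x hx y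
    exact hc.closure_subset_iff.2 hle (hs x)
  refine eq_top_iff.2 fun z _ => ?_
  refine hP.closure_subset_iff.2 ?_ (dense_span_vec z)
  exact Submodule.span_le.2 (by rintro _ ⟨x, y, rfl⟩; exact h2 x y)

variable (X Y Z) in
/-- The isometric embedding of the algebraic tensor product `(X ⊗ Y) ⊗ Z`. -/
def embL : (X ⊗[ℂ] Y) ⊗[ℂ] Z →ₗᵢ[ℂ] HT (HT X Y) Z :=
  (emb (HT X Y) Z).comp ((emb X Y).rTensor Z)

variable (X Y Z) in
/-- The isometric embedding of the algebraic tensor product `X ⊗ (Y ⊗ Z)`. -/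
def embR : X ⊗[ℂ] (Y ⊗[ℂ] Z) →ₗᵢ[ℂ] HT X (HT Y Z) :=
  (emb X (HT Y Z)).comp ((emb Y Z).lTensor X)

theorem denseRange_embL : DenseRange (embL X Y Z) := by
  have := vec_mem_closure_span (X := HT X Y) (Y := Z) (s := Set.range (emb X Y)) (t := Set.univ)
    (denseRange_emb.mono Submodule.subset_span) (by simp)
    (LinearMap.range (embL X Y Z).toLinearMap).topologicalClosure
    (Submodule.isClosed_topologicalClosure _) (by
      rintro _ ⟨t, rfl⟩ z -
      exact Submodule.le_topologicalClosure _ ⟨t ⊗ₜ z, rfl⟩)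
  exact Submodule.dense_iff_topologicalClosure_eq_top.2 this

theorem denseRange_embR : DenseRange (embR X Y Z) := by
  have := vec_mem_closure_span (X := X) (Y := HT Y Z) (s := Set.univ) (t := Set.range (emb Y Z))
    (by simp) (denseRange_emb.mono Submodule.subset_span)
    (LinearMap.range (embR X Y Z).toLinearMap).topologicalClosure
    (Submodule.isClosed_topologicalClosure _) (by
      rintro x - _ ⟨t, rfl⟩
      exact Submodule.le_topologicalClosure _ ⟨x ⊗ₜ t, rfl⟩)
  exact Submodule.dense_iff_topologicalClosure_eq_top.2 this

variable (X Y Z) in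
/-- The canonical unitary `(X ⊗ Y) ⊗ Z ≃ X ⊗ (Y ⊗ Z)`. -/
def assoc : HT (HT X Y) Z ≃ₗᵢ[ℂ] HT X (HT Y Z) :=
  LinearEquiv.extendOfIsometry (TensorProduct.assocIsometry ℂ X Y Z).toLinearEquiv
    (embL X Y Z).toLinearMap (embR X Y Z).toLinearMap denseRange_embL denseRange_embR
    (fun t => by simp)

@[simp] theorem assoc_vec (x : X) (y : Y) (z : Z) :
    assoc X Y Z (vec (vec x y) z) = vec x (vec y z) :=
  LinearEquiv.extendOfIsometry_eq (TensorProduct.assocIsometry ℂ X Y Z).toLinearEquiv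
    (embL X Y Z).toLinearMap (embR X Y Z).toLinearMap denseRange_embL denseRange_embR
    (fun t => by simp) ((x ⊗ₜ y) ⊗ₜ z)

/-- For an operator `T` on `Y ⊗ Z`, the operator `I_X ⊗ T`, acting on `(X ⊗ Y) ⊗ Z`. -/
def amp (X : Type*) [NormedAddCommGroup X] [InnerProductSpace ℂ X] (T : Bd (HT Y Z)) :
    Bd (HT (HT X Y) Z) :=
  ((assoc X Y Z).symm.toContinuousLinearEquiv : HT X (HT Y Z) →L[ℂ] HT (HT X Y) Z) ∘L
    op (1 : Bd X) T ∘L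
    ((assoc X Y Z).toContinuousLinearEquiv : HT (HT X Y) Z →L[ℂ] HT X (HT Y Z))

end Tensor

section L2

variable {ι κ : Type*}

open Classical in
/-- The canonical orthonormal basis vector `e_i` of `ℓ²(ι)`. -/
def e (i : ι) : L2 ι := lp.single 2 i (1 : ℂ)

theorem orthonormal_e : Orthonormal ℂ (e : ι → L2 ι) := by
  classical
  rw [orthonormal_iff_ite]
  intro i j
  simp only [e, lp.inner_single_left]
  simp [Pi.single_apply]

theorem dense_span_e : Dense (Submodule.span ℂ (Set.range (e : ι → L2 ι)) : Set (L2 ι)) := by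
  classical
  intro ξ
  refine mem_closure_of_tendsto (lp.hasSum_single (by simp) ξ) (Filter.Eventually.of_forall ?_)
  intro s
  refine sum_mem fun i _ => ?_
  have : lp.single 2 i (ξ i) = ξ i • (e i : L2 ι) := by
    simp [e, ← lp.single_smul]
  rw [this]
  exact Submodule.smul_mem _ _ (Submodule.subset_span ⟨i, rfl⟩)

/-- The unitary on `ℓ²(ι)` with `e_i ↦ e_{σ i}`. -/
def perm (σ : Equiv.Perm ι) : L2 ι ≃ₗᵢ[ℂ] L2 ι where
  toFun ξ := ⟨fun i => ξ (σ.symm i), memℓp_gen <|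
    (σ.symm.summable_iff (f := fun i => ‖ξ i‖ ^ (2 : ℝ≥0∞).toReal)).2 <|
      (lp.memℓp ξ).summable (by simp)⟩
  invFun ξ := ⟨fun i => ξ (σ i), memℓp_gen <|
    (σ.summable_iff (f := fun i => ‖ξ i‖ ^ (2 : ℝ≥0∞).toReal)).2 <|
      (lp.memℓp ξ).summable (by simp)⟩
  map_add' ξ η := rfl
  map_smul' c ξ := rfl
  left_inv ξ := by ext i; simp
  right_inv ξ := by ext i; simp
  norm_map' ξ := by
    rw [lp.norm_eq_tsum_rpow (by simp), lp.norm_eq_tsum_rpow (by simp)]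
    congr 1
    exact σ.symm.tsum_eq (fun i => ‖ξ i‖ ^ (2 : ℝ≥0∞).toReal)

@[simp] theorem perm_e (σ : Equiv.Perm ι) (i : ι) : perm σ (e i) = e (σ i) := by
  classical
  ext j
  change (e i : L2 ι) (σ.symm j) = (e (σ i) : L2 ι) j
  simp [e, Pi.single_apply, Equiv.symm_apply_eq]

/-- The multiplication operator `M_f` on `ℓ²(ι)`, for `f ∈ ℓ^∞(ι)`. -/
def mulOp (f : lp (fun _ : ι => ℂ) ∞) : Bd (L2 ι) :=
  lp.mapCLM 2 (fun i => ContinuousLinearMap.mul ℂ ℂ (f i)) (norm_nonneg f) fun i => by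
    simpa using lp.norm_apply_le_norm (by simp) f i

theorem mulOp_apply (f : lp (fun _ : ι => ℂ) ∞) (ξ : L2 ι) (i : ι) : mulOp f ξ i = f i * ξ i := rfl

/-- The orthonormal basis `e_i ⊗ e_j` of `ℓ²(ι) ⊗ ℓ²(κ)`. -/
def prodBasis (ι κ : Type*) : HilbertBasis (ι × κ) ℂ (HT (L2 ι) (L2 κ)) :=
  HilbertBasis.mk (v := fun p : ι × κ => vec (e p.1) (e p.2))
    (by
      classical
      rw [orthonormal_iff_ite]
      rintro ⟨i, j⟩ ⟨i', j'⟩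
      rw [inner_vec, orthonormal_iff_ite.1 orthonormal_e, orthonormal_iff_ite.1 orthonormal_e]
      simp [Prod.ext_iff, ← ite_and, and_comm])
    (vec_mem_closure_span dense_span_e dense_span_e _ (Submodule.isClosed_topologicalClosure _) (by
      rintro _ ⟨i, rfl⟩ _ ⟨j, rfl⟩
      exact Submodule.le_topologicalClosure _ (Submodule.subset_span ⟨(i, j), rfl⟩))).ge

/-- The canonical unitary `ℓ²(ι) ⊗ ℓ²(κ) ≃ ℓ²(ι × κ)`. -/
def prodEquiv (ι κ : Type*) : HT (L2 ι) (L2 κ) ≃ₗᵢ[ℂ] L2 (ι × κ) := (prodBasis ι κ).repr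

@[simp] theorem prodEquiv_vec (i : ι) (j : κ) : prodEquiv ι κ (vec (e i) (e j)) = e (i, j) := by
  classical
  have h : vec (e i) (e j) = prodBasis ι κ (i, j) := by simp [prodBasis]
  rw [h, prodEquiv, HilbertBasis.repr_self]
  simp only [e]
  congr
  exact Subsingleton.elim _ _

/-- The operator on `ℓ²(ι) ⊗ ℓ²(κ)` corresponding to an operator on `ℓ²(ι × κ)`. -/
def onPair (T : Bd (L2 (ι × κ))) : Bd (HT (L2 ι) (L2 κ)) :=
  ((prodEquiv ι κ).symm.toContinuousLinearEquiv : L2 (ι × κ) →L[ℂ] HT (L2 ι) (L2 κ)) ∘L T ∘L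
    ((prodEquiv ι κ).toContinuousLinearEquiv : HT (L2 ι) (L2 κ) →L[ℂ] L2 (ι × κ))

/-- A unitary as a bounded operator. -/
def unitaryOp {X : Type*} [NormedAddCommGroup X] [InnerProductSpace ℂ X] (W : X ≃ₗᵢ[ℂ] X) : Bd X :=
  (W.toContinuousLinearEquiv : X →L[ℂ] X)

@[simp] theorem unitaryOp_apply {X : Type*} [NormedAddCommGroup X] [InnerProductSpace ℂ X]
    (W : X ≃ₗᵢ[ℂ] X) (x : X) : unitaryOp W x = W x := rfl

end L2

/-! ## Operator algebras, minimal tensor products, completely contractive maps -/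

section OperatorAlgebras

variable {X Y : Type*} [NormedAddCommGroup X] [InnerProductSpace ℂ X]
  [NormedAddCommGroup Y] [InnerProductSpace ℂ Y]

/-- The norm-closed subalgebra of `𝔹(X)` generated by `S`. -/
def closedAlg (S : Set (Bd X)) : NonUnitalSubalgebra ℂ (Bd X) :=
  (NonUnitalAlgebra.adjoin ℂ S).topologicalClosure

theorem subset_closedAlg (S : Set (Bd X)) : S ⊆ closedAlg S :=
  (NonUnitalAlgebra.subset_adjoin ℂ).trans (NonUnitalSubalgebra.le_topologicalClosure _)

theorem closedAlg_le {S : Set (Bd X)} {P : NonUnitalSubalgebra ℂ (Bd X)}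
    (hP : IsClosed (P : Set (Bd X))) (h : S ⊆ P) : closedAlg S ≤ P :=
  NonUnitalSubalgebra.topologicalClosure_minimal (NonUnitalAlgebra.adjoin_le h) hP

/-- The minimal (spatial) tensor product `A ⊗ B ⊆ 𝔹(X ⊗ Y)` of `A ⊆ 𝔹(X)` and `B ⊆ 𝔹(Y)`, that is,
the norm closure of the span of the operators `a ⊗ b`. (These are closed under multiplication, so
their span is the algebra that they generate.) -/
def minTensor (A : NonUnitalSubalgebra ℂ (Bd X)) (B : NonUnitalSubalgebra ℂ (Bd Y)) :
    NonUnitalSubalgebra ℂ (Bd (HT X Y)) :=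
  closedAlg {T | ∃ a ∈ A, ∃ b ∈ B, T = op a b}

/-- The algebra `𝕂(X)` of compact operators. -/
def compacts (X : Type*) [NormedAddCommGroup X] [InnerProductSpace ℂ X] :
    NonUnitalSubalgebra ℂ (Bd X) where
  carrier := {T | IsCompactOperator T}
  zero_mem' := isCompactOperator_zero
  add_mem' hS hT := hS.add hT
  smul_mem' c _ hT := hT.smul c
  mul_mem' {S _} _ hT := hT.clm_comp S

variable [CompleteSpace X] [CompleteSpace Y]
  {A : NonUnitalSubalgebra ℂ (Bd X)} {B : NonUnitalSubalgebra ℂ (Bd Y)}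

/-- `φ : A → B` is completely contractive: all its amplifications `M_n(A) → M_n(B)` are
contractive, where `M_n(A)` carries the norm of the C*-algebra `M_n(𝔹(X))`. -/
def CompletelyContractive (φ : A →ₙₐ[ℂ] B) : Prop :=
  ∀ (n : ℕ) (m : Matrix (Fin n) (Fin n) A),
    ‖CStarMatrix.ofMatrix (m.map fun a => (φ a : Bd Y))‖ ≤
      ‖CStarMatrix.ofMatrix (m.map fun a => (a : Bd X))‖

/-- `φ : A → B` is completely isometric: all its amplifications are isometric. -/
def CompletelyIsometric (φ : A →ₙₐ[ℂ] B) : Prop :=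
  ∀ (n : ℕ) (m : Matrix (Fin n) (Fin n) A),
    ‖CStarMatrix.ofMatrix (m.map fun a => (φ a : Bd Y))‖ =
      ‖CStarMatrix.ofMatrix (m.map fun a => (a : Bd X))‖

end OperatorAlgebras

/-- Let `gen` be a set of prescribed values `x ↦ y`. `Extends gen x y` says that the continuous
linear extension of these prescriptions sends `x` to `y`: the pair `(x, y)` is a limit of finite
linear combinations of elements of `gen`. It is used for tensor products of completely bounded maps,
prescribed on elementary tensors, `φ ⊗ ψ : a ⊗ b ↦ φ a ⊗ ψ b`: such a prescription is bounded on
the span of the elementary tensors, so the closure of its graph is the graph of the map `φ ⊗ ψ` on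
the minimal tensor product. -/
def Extends {E F : Type*} [NormedAddCommGroup E] [NormedSpace ℂ E] [NormedAddCommGroup F]
    [NormedSpace ℂ F] (gen : Set (E × F)) (x : E) (y : F) : Prop :=
  (x, y) ∈ (Submodule.span ℂ gen).topologicalClosure

/-! ## Group C*-algebras -/

section Group

variable {G : Type*} [Group G]

/-- The left regular representation, `λ_g e_h = e_{gh}`. -/
def lam (g : G) : Bd (L2 G) := unitaryOp (perm (Equiv.mulLeft g))

/-- The unitary representations of `G` on `ℓ²(G × ℕ)`. -/
abbrev Reps (G : Type*) [Group G] := G →* (L2 (G × ℕ) ≃ₗᵢ[ℂ] L2 (G × ℕ))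

/-- The Hilbert space of the direct sum of all the unitary representations on `ℓ²(G × ℕ)`. -/
abbrev HU (G : Type*) [Group G] := lp (fun _ : Reps G => L2 (G × ℕ)) 2

/-- The universal representation `g ↦ u_g`, the direct sum of all unitary representations of `G` on
`ℓ²(G × ℕ)`. A cyclic representation of `G` has dimension at most `|G × ℕ|`, so that its sum with a
trivial representation of dimension `|G × ℕ|` is unitarily equivalent to one of the summands.
Hence `‖∑ c_g u_g‖` is the supremum of `‖∑ c_g π(g)‖` over all unitary representations `π`. -/
def univ (g : G) : Bd (HU G) :=
  lp.mapCLM 2 (fun π : Reps G => unitaryOp (π g)) zero_le_one fun π =>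
    (unitaryOp (π g)).opNorm_le_bound zero_le_one fun x => by simp

@[simp] theorem univ_apply (g : G) (ξ : HU G) (π : Reps G) : univ g ξ π = π g (ξ π) := rfl

/-- The C*-algebra generated by a unitary representation `w` of `G`, that is, the closed span of the
operators `w g`. For `w = univ` this is the full group C*-algebra `C*(G)`, for `w = lam` it is the
reduced group C*-algebra `C*_λ(G)`. -/
def groupAlg {K : Type*} [NormedAddCommGroup K] [InnerProductSpace ℂ K] (w : G → Bd K) :
    NonUnitalSubalgebra ℂ (Bd K) := closedAlg (Set.range w)

variable (G) in
/-- The full group C*-algebra `C*(G)`, in its universal representation. -/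
abbrev CFull : NonUnitalSubalgebra ℂ (Bd (HU G)) := groupAlg (univ (G := G))

variable (G) in
/-- The reduced group C*-algebra `C*_λ(G)`. -/
abbrev CRed : NonUnitalSubalgebra ℂ (Bd (L2 G)) := groupAlg (lam (G := G))

/-- The representation of `G` on `ℓ²(G × ℕ) = ℓ²(G) ⊗ ℓ²(ℕ)` by `g ↦ λ_g ⊗ I`. -/
def lamRep (G : Type*) [Group G] : Reps G where
  toFun g := perm ((Equiv.mulLeft g).prodCongr (Equiv.refl ℕ))
  map_one' := by
    ext ξ p
    change ξ (1⁻¹ * p.1, p.2) = ξ p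
    simp
  map_mul' g h := by
    ext ξ p
    change ξ ((g * h)⁻¹ * p.1, p.2) = ξ (h⁻¹ * (g⁻¹ * p.1), p.2)
    simp [mul_assoc]

open Classical in
/-- The vector `e_(g,0)` in the summand of `HU G` on which `G` acts by `lamRep`. -/
def jVec (g : G) : HU G := lp.single 2 (lamRep G) (e (g, 0))

theorem orthonormal_jVec : Orthonormal ℂ (jVec : G → HU G) := by
  classical
  rw [orthonormal_iff_ite]
  intro g h
  rw [jVec, jVec, lp.inner_single_left, lp.single_apply_self,
    orthonormal_iff_ite.1 orthonormal_e]
  simp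

/-- An isometric embedding of `ℓ²(G)` into the space of the universal representation, intertwining
the left regular with the universal representation. -/
def jLam (G : Type*) [Group G] : L2 G →ₗᵢ[ℂ] HU G :=
  (orthonormal_jVec (G := G)).orthogonalFamily.linearIsometry

theorem jLam_e (g : G) : jLam G (e g) = jVec g := by
  classical
  rw [jLam, e, OrthogonalFamily.linearIsometry_apply_single]
  simp

/-- The embedding `jLam` as a bounded operator. -/
def jL (G : Type*) [Group G] : L2 G →L[ℂ] HU G := (jLam G).toContinuousLinearMap

/-- The adjoint of the embedding `jLam`. -/
def jLadj (G : Type*) [Group G] : HU G →L[ℂ] L2 G := ContinuousLinearMap.adjoint (jL G)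

theorem jLadj_comp_jL : jLadj G ∘L jL G = ContinuousLinearMap.id ℂ (L2 G) :=
  (ContinuousLinearMap.norm_map_iff_adjoint_comp_self (jL G)).1 (jLam G).norm_map

theorem univ_comp_jL (g : G) : univ g ∘L jL G = jL G ∘L lam g := by
  classical
  refine ContinuousLinearMap.ext_on dense_span_e ?_
  rintro _ ⟨h, rfl⟩
  change univ g (jLam G (e h)) = jLam G (perm (Equiv.mulLeft g) (e h))
  rw [perm_e, jLam_e, jLam_e]
  ext1
  funext π
  rw [univ_apply]
  by_cases hπ : π = lamRep G
  · subst hπ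
    simp only [jVec, lp.single_apply_self]
    exact perm_e _ _
  · simp [jVec, hπ]

/-! ### The map `id ⊗ λ` -/

section Compress

variable {X Y : Type*} [NormedAddCommGroup X] [InnerProductSpace ℂ X]
  [NormedAddCommGroup Y] [InnerProductSpace ℂ Y]

/-- The operators `x` with `x J = J (J' x J)`. -/
def interAlg (J : X →L[ℂ] Y) (J' : Y →L[ℂ] X) : NonUnitalSubalgebra ℂ (Bd Y) where
  carrier := {x | x ∘L J = J ∘L J' ∘L x ∘L J}
  zero_mem' := by simp
  add_mem' {x y} hx hy := by
    simp only [Set.mem_ofPred_eq] at *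
    simp only [ContinuousLinearMap.add_comp, ContinuousLinearMap.comp_add, ← hx, ← hy]
  smul_mem' c x hx := by
    simp only [Set.mem_ofPred_eq] at *
    simp only [ContinuousLinearMap.smul_comp, ContinuousLinearMap.comp_smul, ← hx]
  mul_mem' {x y} hx hy := by
    simp only [Set.mem_ofPred_eq] at *
    ext v
    have hx' (v : X) : x (J v) = J (J' (x (J v))) := congrArg (fun T => T v) hx
    have hy' (v : X) : y (J v) = J (J' (y (J v))) := congrArg (fun T => T v) hy
    change x (y (J v)) = J (J' (x (y (J v))))
    rw [hy' v]
    exact hx' _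

theorem isClosed_interAlg (J : X →L[ℂ] Y) (J' : Y →L[ℂ] X) :
    IsClosed (interAlg J J' : Set (Bd Y)) :=
  isClosed_eq (by fun_prop) (by fun_prop)

/-- The compression `x ↦ J' x J`. -/
def compress (J : X →L[ℂ] Y) (J' : Y →L[ℂ] X) : interAlg J J' →ₙₐ[ℂ] Bd X where
  toFun x := J' ∘L (x : Bd Y) ∘L J
  map_smul' c x := by simp
  map_zero' := by simp
  map_add' x y := by simp
  map_mul' x y := by
    ext v
    have hy' (v : X) : (y : Bd Y) (J v) = J (J' ((y : Bd Y) (J v))) :=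
      congrArg (fun T => T v) y.2
    change J' ((x : Bd Y) ((y : Bd Y) (J v))) = J' ((x : Bd Y) (J (J' ((y : Bd Y) (J v)))))
    rw [← hy' v]

theorem compress_mem {J : X →L[ℂ] Y} {J' : Y →L[ℂ] X} {S : Set (Bd Y)}
    {P : NonUnitalSubalgebra ℂ (Bd X)} (hS : closedAlg S ≤ interAlg J J')
    (hP : IsClosed (P : Set (Bd X))) (h : ∀ x ∈ S, J' ∘L x ∘L J ∈ P) {x : Bd Y}
    (hx : x ∈ closedAlg S) : J' ∘L x ∘L J ∈ P := by
  have hc : IsClosed {x : Bd Y | J' ∘L x ∘L J ∈ P} :=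
    hP.preimage (f := fun x : Bd Y => J' ∘L x ∘L J) (by fun_prop)
  refine hc.closure_subset_iff.2 ?_ hx
  intro y hy
  induction hy using NonUnitalAlgebra.adjoin_induction with
  | mem y hy => exact h y hy
  | zero => simp
  | add y z _ _ hy hz =>
    simp only [Set.mem_ofPred_eq, ContinuousLinearMap.add_comp,
      ContinuousLinearMap.comp_add] at *
    exact add_mem hy hz
  | smul c y _ hy =>
    simp only [Set.mem_ofPred_eq, ContinuousLinearMap.smul_comp,
      ContinuousLinearMap.comp_smul] at *
    exact P.smul_mem c hy
  | mul y z hy' hz' hy hz =>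
    have hmul := map_mul (compress J J')
      ⟨y, hS (NonUnitalSubalgebra.le_topologicalClosure _ hy')⟩
      ⟨z, hS (NonUnitalSubalgebra.le_topologicalClosure _ hz')⟩
    change J' ∘L (y * z) ∘L J = (J' ∘L y ∘L J) * (J' ∘L z ∘L J) at hmul
    change J' ∘L (y * z) ∘L J ∈ P
    rw [hmul]
    exact mul_mem hy hz

end Compress

variable {H : Type*} [NormedAddCommGroup H] [InnerProductSpace ℂ H]

theorem isClosed_minTensor {X Y : Type*} [NormedAddCommGroup X] [InnerProductSpace ℂ X]
    [NormedAddCommGroup Y] [InnerProductSpace ℂ Y] (A : NonUnitalSubalgebra ℂ (Bd X))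
    (B : NonUnitalSubalgebra ℂ (Bd Y)) : IsClosed (minTensor A B : Set (Bd (HT X Y))) :=
  NonUnitalSubalgebra.isClosed_topologicalClosure _

theorem groupAlg_le_interAlg : CFull G ≤ interAlg (jL G) (jLadj G) := by
  refine closedAlg_le (isClosed_interAlg _ _) ?_
  rintro _ ⟨g, rfl⟩
  change univ g ∘L jL G = jL G ∘L jLadj G ∘L univ g ∘L jL G
  rw [univ_comp_jL, ← ContinuousLinearMap.comp_assoc (jLadj G), jLadj_comp_jL,
    ContinuousLinearMap.id_comp]

theorem compress_mem_groupAlg {b : Bd (HU G)} (hb : b ∈ CFull G) :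
    jLadj G ∘L b ∘L jL G ∈ CRed G := by
  refine compress_mem groupAlg_le_interAlg (NonUnitalSubalgebra.isClosed_topologicalClosure _)
    ?_ hb
  rintro _ ⟨g, rfl⟩
  rw [univ_comp_jL, ← ContinuousLinearMap.comp_assoc (jLadj G), jLadj_comp_jL,
    ContinuousLinearMap.id_comp]
  exact subset_closedAlg _ ⟨g, rfl⟩

theorem minTensor_le_interAlg (A : NonUnitalSubalgebra ℂ (Bd H)) :
    minTensor A (CFull G) ≤
      interAlg (op (ContinuousLinearMap.id ℂ H) (jL G))
        (op (ContinuousLinearMap.id ℂ H) (jLadj G)) := by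
  refine closedAlg_le (isClosed_interAlg _ _) ?_
  rintro _ ⟨a, -, b, hb, rfl⟩
  have hb' : b ∘L jL G = jL G ∘L jLadj G ∘L b ∘L jL G := groupAlg_le_interAlg hb
  change op a b ∘L op _ _ = op _ _ ∘L op _ _ ∘L op a b ∘L op _ _
  simp only [op_comp]
  rw [← hb']
  simp

/-- The homomorphism `id ⊗ λ : A ⊗ C*(G) → A ⊗ C*_λ(G)`, with `a ⊗ u_g ↦ a ⊗ λ_g`. It is
the compression to `H ⊗ ℓ²(G)`, as `λ` is a subrepresentation of the universal representation. -/
def idTensorLam (G : Type*) [Group G] (A : NonUnitalSubalgebra ℂ (Bd H)) :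
    minTensor A (CFull G) →ₙₐ[ℂ] minTensor A (CRed G) :=
  NonUnitalAlgHom.codRestrict
    ((compress (op (ContinuousLinearMap.id ℂ H) (jL G))
      (op (ContinuousLinearMap.id ℂ H) (jLadj G))).comp
      (NonUnitalSubalgebra.inclusion (minTensor_le_interAlg A))) _ (by
    rintro ⟨x, hx⟩
    refine compress_mem (minTensor_le_interAlg A) (isClosed_minTensor A (CRed G)) ?_ hx
    rintro _ ⟨a, ha, b, hb, rfl⟩
    simp only [op_comp]
    exact subset_closedAlg _ ⟨a, ha, _, compress_mem_groupAlg hb, by simp⟩)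

theorem idTensorLam_apply (A : NonUnitalSubalgebra ℂ (Bd H))
    (x : minTensor A (CFull G)) :
    (idTensorLam G A x : Bd (HT H (L2 G))) =
      op (ContinuousLinearMap.id ℂ H) (jLadj G) ∘L (x : Bd (HT H (HU G))) ∘L
        op (ContinuousLinearMap.id ℂ H) (jL G) := rfl

theorem idTensorLam_op (A : NonUnitalSubalgebra ℂ (Bd H)) (a : Bd H) (ha : a ∈ A) (g : G) :
    (idTensorLam G A ⟨op a (univ g), subset_closedAlg _ ⟨a, ha, univ g,
      subset_closedAlg _ ⟨g, rfl⟩, rfl⟩⟩ : Bd (HT H (L2 G))) = op a (lam g) := by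
  rw [idTensorLam_apply]
  simp only [op_comp]
  rw [univ_comp_jL, ← ContinuousLinearMap.comp_assoc (jLadj G), jLadj_comp_jL]
  simp

end Group

/-! ## Coactions -/

section Coaction

variable {G : Type*} [Group G] {X K : Type*} [NormedAddCommGroup X] [InnerProductSpace ℂ X]
  [NormedAddCommGroup K] [InnerProductSpace ℂ K]

/-- The coaction identity and nondegeneracy for a homomorphism `ε : A → A ⊗ C*_w`, where `C*_w` is
the C*-algebra generated by the unitary representation `w` (`univ` or `lam`).
* Coaction identity: `(ε ⊗ id)(ε a) = (id ⊗ Δ)(ε a)`, where `Δ(w_g) = w_g ⊗ w_g`.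
* Nondegeneracy: the closed span of `ε(A)(I ⊗ C*_w)` is `A ⊗ C*_w`. -/
structure CoactionAxioms (w : G → Bd K) (A : NonUnitalSubalgebra ℂ (Bd X))
    (ε : A →ₙₐ[ℂ] minTensor A (groupAlg w)) : Prop where
  coaction_identity : ∀ a : A, ∃ y : Bd (HT (HT X K) K),
    Extends {p | ∃ (b : A), ∃ c ∈ groupAlg w, p = (op (b : Bd X) c, op (ε b : Bd (HT X K)) c)}
      (ε a : Bd (HT X K)) y ∧
    Extends {p | ∃ (b : A) (g : G), p = (op (b : Bd X) (w g), op (op (b : Bd X) (w g)) (w g))}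
      (ε a : Bd (HT X K)) y
  nondegenerate :
    (Submodule.span ℂ {x : Bd (HT X K) | ∃ (a : A), ∃ c ∈ groupAlg w,
      x = (ε a : Bd (HT X K)) * op (1 : Bd X) c}).topologicalClosure =
    (minTensor A (groupAlg w)).toSubmodule

variable [CompleteSpace X] (A : NonUnitalSubalgebra ℂ (Bd X))

/-- A coaction of the discrete group `G` on the operator algebra `A`: a completely contractive
homomorphism `δ : A → A ⊗ C*(G)` satisfying the coaction identity and nondegeneracy. -/
structure IsCoaction (δ : A →ₙₐ[ℂ] minTensor A (CFull G)) : Prop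
    extends CoactionAxioms (univ (G := G)) A δ where
  completelyContractive : CompletelyContractive δ

/-- A reduced coaction of the discrete group `G` on the operator algebra `A`: a completely isometric
homomorphism `ε : A → A ⊗ C*_λ(G)` satisfying the coaction identity and nondegeneracy. -/
structure IsReducedCoaction (ε : A →ₙₐ[ℂ] minTensor A (CRed G)) : Prop
    extends CoactionAxioms (lam (G := G)) A ε where
  completelyIsometric : CompletelyIsometric ε

variable {A}

/-- `δ_λ = (id ⊗ λ) ∘ δ : A → A ⊗ C*_λ(G)`. -/
def dlam (δ : A →ₙₐ[ℂ] minTensor A (CFull G)) : A →ₙₐ[ℂ] minTensor A (CRed G) :=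
  (idTensorLam G A).comp δ

/-- The coaction `δ` is normal if `δ_λ` is completely isometric. -/
def IsNormal (δ : A →ₙₐ[ℂ] minTensor A (CFull G)) : Prop := CompletelyIsometric (dlam δ)

/-- The operator algebra `δ_λ(A) ⊆ 𝔹(X ⊗ ℓ²(G))`. -/
def dlamRange (δ : A →ₙₐ[ℂ] minTensor A (CFull G)) : NonUnitalSubalgebra ℂ (Bd (HT X (L2 G))) :=
  (NonUnitalAlgHom.range (dlam δ)).map (NonUnitalSubalgebraClass.subtype (minTensor A (CRed G)))

end Coaction

/-! ## The double crossed product -/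

section Double

variable {G : Type*} [Group G]

/-- `ν(f)(g, h) = f(g h⁻¹)`. -/
def nu (f : lp (fun _ : G => ℂ) ∞) : lp (fun _ : G × G => ℂ) ∞ :=
  ⟨fun p => f (p.1 * p.2⁻¹), memℓp_infty ⟨‖f‖, by
    rintro _ ⟨p, rfl⟩
    exact lp.norm_apply_le_norm (by simp) f _⟩⟩

variable (G) in
/-- `c₀(G)`, the bounded functions on `G` that vanish at infinity. -/
def c0 : Set (lp (fun _ : G => ℂ) ∞) := {f | Filter.Tendsto (fun g => f g) Filter.cofinite (𝓝 0)}

variable (G) in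
/-- The unitary `U` with `U(e_g ⊗ e_h) = e_g ⊗ e_{gh}`. -/
def U : Bd (HT (L2 G) (L2 G)) :=
  onPair (unitaryOp (perm
    { toFun := fun p : G × G => (p.1, p.1 * p.2)
      invFun := fun p => (p.1, p.1⁻¹ * p.2)
      left_inv := fun p => by simp
      right_inv := fun p => by simp }))

variable (G) in
/-- The unitary `S` with `S(e_g ⊗ e_h) = e_g ⊗ e_{h⁻¹}`. -/
def S : Bd (HT (L2 G) (L2 G)) :=
  onPair (unitaryOp (perm
    { toFun := fun p : G × G => (p.1, p.2⁻¹)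
      invFun := fun p => (p.1, p.2⁻¹)
      left_inv := fun p => by simp
      right_inv := fun p => by simp }))

theorem U_vec (g h : G) : U G (vec (e g) (e h)) = vec (e g) (e (g * h)) := by
  change (prodEquiv G G).symm (perm _ (prodEquiv G G (vec (e g) (e h)))) = _
  rw [LinearIsometryEquiv.symm_apply_eq]
  simp

theorem S_vec (g h : G) : S G (vec (e g) (e h)) = vec (e g) (e h⁻¹) := by
  change (prodEquiv G G).symm (perm _ (prodEquiv G G (vec (e g) (e h)))) = _
  rw [LinearIsometryEquiv.symm_apply_eq]
  simp

variable {H : Type*} [NormedAddCommGroup H] [InnerProductSpace ℂ H]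
  {A : NonUnitalSubalgebra ℂ (Bd H)}

/-- `k_A(a) = δ_λ(a) ⊗ I`. -/
def kA (δ : A →ₙₐ[ℂ] minTensor A (CFull G)) (a : A) : Bd (HT (HT H (L2 G)) (L2 G)) :=
  op (dlam δ a : Bd (HT H (L2 G))) 1

/-- `k_{c₀(G)}(f) = I ⊗ (M ⊗ M)(ν(f))`, where `(M ⊗ M)(F)` is multiplication by `F` on
`ℓ²(G) ⊗ ℓ²(G) = ℓ²(G × G)`. -/
def kc0 (H : Type*) [NormedAddCommGroup H] [InnerProductSpace ℂ H] (f : lp (fun _ : G => ℂ) ∞) :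
    Bd (HT (HT H (L2 G)) (L2 G)) :=
  amp H (onPair (mulOp (nu f)))

/-- `k_G(g) = I ⊗ I ⊗ λ_g`. -/
def kG (H : Type*) [NormedAddCommGroup H] [InnerProductSpace ℂ H] (g : G) :
    Bd (HT (HT H (L2 G)) (L2 G)) :=
  op 1 (lam g)

/-- The reduced double crossed product `A ⋊_δ G ⋊^r_δ̂ G`, the closed algebra generated by
`k_A(A) k_{c₀(G)}(c₀(G)) k_G(G)`. -/
def doubleCrossed (δ : A →ₙₐ[ℂ] minTensor A (CFull G)) :
    NonUnitalSubalgebra ℂ (Bd (HT (HT H (L2 G)) (L2 G))) :=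
  closedAlg {x | ∃ (a : A), ∃ f ∈ c0 G, ∃ g : G, x = kA δ a * kc0 H f * kG H g}

/-- The reduced coaction `δ̃` on `δ_λ(A) ⊗ 𝕂` is to be given by
`δ̃(x) = (I ⊗ I ⊗ U*) [((δ_λ ⊗ Σ) ∘ (δ_λ ⊗ id) ∘ (δ_λ⁻¹ ⊗ id))(x)] (I ⊗ I ⊗ U)`,
where `Σ : C*_λ(G) ⊗ 𝕂 → 𝕂 ⊗ C*_λ(G)` is the flip. The predicate `TildeFormula δ x y` says that the
value of this formula at `x` is `y`. The three maps in the middle are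
`δ_λ⁻¹ ⊗ id : δ_λ(A) ⊗ 𝕂 → A ⊗ 𝕂`, `δ_λ ⊗ id : A ⊗ 𝕂 → A ⊗ C*_λ(G) ⊗ 𝕂` and
`δ_λ ⊗ Σ : A ⊗ C*_λ(G) ⊗ 𝕂 → A ⊗ C*_λ(G) ⊗ 𝕂 ⊗ C*_λ(G)`. -/
def TildeFormula [CompleteSpace H] (δ : A →ₙₐ[ℂ] minTensor A (CFull G))
    (x : Bd (HT (HT H (L2 G)) (L2 G))) (y : Bd (HT (HT (HT H (L2 G)) (L2 G)) (L2 G))) : Prop :=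
  ∃ (x₁ : Bd (HT H (L2 G))) (x₂ : Bd (HT (HT H (L2 G)) (L2 G)))
    (x₃ : Bd (HT (HT (HT H (L2 G)) (L2 G)) (L2 G))),
    Extends {p | ∃ (a : A), ∃ k ∈ compacts (L2 G),
      p = (op (dlam δ a : Bd (HT H (L2 G))) k, op (a : Bd H) k)} x x₁ ∧
    Extends {p | ∃ (a : A), ∃ k ∈ compacts (L2 G),
      p = (op (a : Bd H) k, op (dlam δ a : Bd (HT H (L2 G))) k)} x₁ x₂ ∧
    Extends {p | ∃ (a : A), ∃ c ∈ CRed G, ∃ k ∈ compacts (L2 G),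
      p = (op (op (a : Bd H) c) k, op (op (dlam δ a : Bd (HT H (L2 G))) k) c)} x₂ x₃ ∧
    y = amp (HT H (L2 G)) (star (U G)) * x₃ * amp (HT H (L2 G)) (U G)

end Double

end Katayama

end

open Katayama

/-!
A coaction of a discrete group is a grading in disguise, and the theorem is a computation with
homogeneous elements. Slicing the coaction identity by the functionals `u_h ↦ [h = s]` produces
elements `a` with `δ(a) = a ⊗ u_s`, hence `δ_λ(a) = a ⊗ λ_s`, and nondegeneracy says that these span
a dense subspace of `A` (`IsCoaction.dense_homogeneous`). For such an `a`, evaluating on the basis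
vectors `v ⊗ e_g ⊗ e_h` shows that conjugation by `V` sends the generator `k_A(a) k_{c₀}(f) k_G(r)`
of the double crossed product to `δ_λ(a) ⊗ λ_s M_f ρ_r` (`conjHom_V_gen`), where `ρ` is the right
regular representation. Here `M_f` is compact; conversely, if `f` is the characteristic function of
a point, then for fixed `s` the operators `λ_s M_f ρ_r` are all the matrix units
(`lam_mul_mulOp_mul_rho`), whose span is dense in the compact operators
(`mem_compacts_closure_span`). So conjugation by `V` maps the double crossed product onto
`δ_λ(A) ⊗ 𝕂`; it is completely isometric because it is the restriction of an injective
*-homomorphism between C*-algebras.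

In the same way, `x ↦ (I ⊗ I ⊗ U)(x ⊗ I)(I ⊗ I ⊗ U*)` is the restriction of a *-homomorphism
(`comult`), which sends the generator above to its tensor product with `λ_r` (`comult_gen`). A
completely isometric homomorphism whose homogeneous elements span a dense subspace is a reduced
coaction (`isReducedCoaction_of_dense_homogeneous`): the map `id ⊗ Δ_λ` in the coaction identity is
again of the form `comult`, hence bounded, and both axioms are evident for homogeneous elements.

The coaction `δ̃` is defined as the conjugate of the double dual coaction by `V`, which makes it a
reduced coaction and the conjugacy with `Ψ` a tautology. What has to be proved is the formula for
it. On `δ_λ(a) ⊗ e_{pq}`, with `a` of degree `s`, both sides are the tensor product with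
`λ_{p⁻¹ s q}` (`tildeHom_matrixUnit`, `conjHom_ampU_matrixUnit`), and it remains to pass to the
limit. The map `δ_λ⁻¹ ⊗ id` is isometric, as `δ_λ` is completely isometric and as the norm of a
finite matrix over `𝔹(X)` is the norm of the corresponding operator on `X ⊗ ℓ²(G)`
(`CompletelyIsometric.exists_extends`). The map `δ_λ ⊗ id` is its inverse, and `δ_λ ⊗ Σ`, which is
only needed on `δ_λ(A) ⊗ 𝕂`, is there the restriction of a *-homomorphism.
-/

noncomputable section

namespace Katayama

/-! ### Operators on Hilbert space tensor products -/

section TensorOperators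

variable {X X' Y Y' Z E : Type*}
  [NormedAddCommGroup X] [InnerProductSpace ℂ X] [NormedAddCommGroup X'] [InnerProductSpace ℂ X']
  [NormedAddCommGroup Y] [InnerProductSpace ℂ Y] [NormedAddCommGroup Y'] [InnerProductSpace ℂ Y']
  [NormedAddCommGroup Z] [InnerProductSpace ℂ Z] [NormedAddCommGroup E] [NormedSpace ℂ E]

theorem vec_add_left (x x' : X) (y : Y) : vec (x + x') y = vec x y + vec x' y := by
  simp [vec, TensorProduct.add_tmul]

theorem vec_add_right (x : X) (y y' : Y) : vec x (y + y') = vec x y + vec x y' := by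
  simp [vec, TensorProduct.tmul_add]

theorem vec_smul_left (c : ℂ) (x : X) (y : Y) : vec (c • x) y = c • vec x y := by
  rw [vec, vec, ← map_smul, TensorProduct.smul_tmul']

theorem vec_smul_right (c : ℂ) (x : X) (y : Y) : vec x (c • y) = c • vec x y := by
  simp [vec]

@[simp] theorem vec_zero_right (x : X) : vec x (0 : Y) = 0 := by simp [vec]

@[simp] theorem vec_zero_left (y : Y) : vec (0 : X) y = 0 := by simp [vec]

theorem norm_op_le (a : X →L[ℂ] X') (b : Y →L[ℂ] Y') : ‖op a b‖ ≤ ‖a‖ * ‖b‖ := by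
  refine ContinuousLinearMap.opNorm_le_bound _ (by positivity) fun z => ?_
  refine isClosed_property (p := fun z => ‖op a b z‖ ≤ ‖a‖ * ‖b‖ * ‖z‖) denseRange_emb
    (isClosed_le (by fun_prop) (by fun_prop)) (fun t => ?_) z
  rw [op_emb, LinearIsometry.norm_map, LinearIsometry.norm_map]
  exact ContinuousLinearMap.le_of_opNorm_le _ (TensorProduct.norm_mapL_le a b) t

variable (X X' Y Y') in
/-- `(a, b) ↦ a ⊗ b` as a bounded bilinear map. -/
def opL : (X →L[ℂ] X') →L[ℂ] (Y →L[ℂ] Y') →L[ℂ] (HT X Y →L[ℂ] HT X' Y') :=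
  LinearMap.mkContinuous₂ (LinearMap.mk₂ ℂ op
    (fun a a' b => clm_ext_vec fun x y => by simp [vec_add_left])
    (fun c a b => clm_ext_vec fun x y => by simp [vec_smul_left])
    (fun a b b' => clm_ext_vec fun x y => by simp [vec_add_right])
    (fun c a b => clm_ext_vec fun x y => by simp [vec_smul_right])) 1
    fun a b => by simpa using norm_op_le a b

@[simp] theorem opL_apply (a : X →L[ℂ] X') (b : Y →L[ℂ] Y') : opL X X' Y Y' a b = op a b := rfl

theorem op_mul (a a' : Bd X) (b b' : Bd Y) : op a b * op a' b' = op (a * a') (b * b') :=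
  op_comp a b a' b'

@[simp] theorem op_one_one : op (1 : Bd X) (1 : Bd Y) = 1 := clm_ext_vec fun x y => by simp

theorem star_op [CompleteSpace X] [CompleteSpace Y] (a : Bd X) (b : Bd Y) :
    star (op a b) = op (star a) (star b) := by
  rw [ContinuousLinearMap.star_eq_adjoint]
  refine clm_ext_vec fun x y => ?_
  refine ext_inner_left ℂ fun z => ?_
  rw [ContinuousLinearMap.adjoint_inner_right]
  -- Both sides are continuous and linear in `z`.
  have : innerSL ℂ (vec x y) ∘L op a b = innerSL ℂ (op (star a) (star b) (vec x y)) :=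
    clm_ext_vec fun x' y' => by
      simp [inner_vec, ContinuousLinearMap.star_eq_adjoint, ContinuousLinearMap.adjoint_inner_left]
  have h := congrArg (fun T => T z) this
  simp only [ContinuousLinearMap.comp_apply, innerSL_apply_apply] at h
  rw [← inner_conj_symm, h, inner_conj_symm]

/-- Operators out of `X ⊗ ℓ²(ι)` are determined by their values on the vectors `x ⊗ e_i`. -/
theorem clm_ext_vec_e {ι : Type*} {S T : HT X (L2 ι) →L[ℂ] E}
    (h : ∀ x i, S (vec x (e i)) = T (vec x (e i))) : S = T := by
  refine clm_ext_vec fun x y => ?_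
  have : S ∘L vecL x = T ∘L vecL x :=
    ContinuousLinearMap.ext_on dense_span_e (by rintro _ ⟨i, rfl⟩; exact h x i)
  exact congrArg (fun R => R y) this

theorem clm_ext_vec_e_e {ι κ : Type*} {S T : HT (HT X (L2 ι)) (L2 κ) →L[ℂ] E}
    (h : ∀ x i j, S (vec (vec x (e i)) (e j)) = T (vec (vec x (e i)) (e j))) : S = T := by
  refine clm_ext_vec_e fun z j => ?_
  have : S ∘L vecL.flip (e j) = T ∘L vecL.flip (e j) := clm_ext_vec_e fun x i => h x i j
  exact congrArg (fun R => R z) this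

theorem amp_vec (T : Bd (HT Y Z)) (x : X) (y : Y) (z : Z) :
    amp X T (vec (vec x y) z) = (assoc X Y Z).symm (vec x (T (vec y z))) := by
  change (assoc X Y Z).symm (op 1 T (assoc X Y Z (vec (vec x y) z))) = _
  simp

@[simp] theorem assoc_symm_vec (x : X) (y : Y) (z : Z) :
    (assoc X Y Z).symm (vec x (vec y z)) = vec (vec x y) z := by
  rw [LinearIsometryEquiv.symm_apply_eq, assoc_vec]

theorem amp_one : amp X (1 : Bd (HT Y Z)) = 1 := by
  ext z
  change (assoc X Y Z).symm (op 1 1 (assoc X Y Z z)) = _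
  simp

theorem amp_mul (S T : Bd (HT Y Z)) : amp X (S * T) = amp X S * amp X T := by
  ext z
  change (assoc X Y Z).symm (op 1 (S * T) (assoc X Y Z z)) =
    (assoc X Y Z).symm (op 1 S (assoc X Y Z ((assoc X Y Z).symm (op 1 T (assoc X Y Z z)))))
  rw [LinearIsometryEquiv.apply_symm_apply, ← one_mul (1 : Bd X), ← op_mul]
  rfl

theorem star_amp [CompleteSpace X] [CompleteSpace Y] [CompleteSpace Z] (T : Bd (HT Y Z)) :
    star (amp X T) = amp X (star T) := by
  rw [amp, amp, ContinuousLinearMap.star_eq_adjoint, ContinuousLinearMap.adjoint_comp,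
    ContinuousLinearMap.adjoint_comp, ← ContinuousLinearMap.star_eq_adjoint (op 1 T), star_op,
    star_one]
  have h1 := LinearIsometryEquiv.adjoint_eq_symm (assoc X Y Z)
  have h2 := LinearIsometryEquiv.adjoint_eq_symm (assoc X Y Z).symm
  rw [ContinuousLinearMap.comp_assoc]
  exact congrArg₂ (fun S R => S ∘L op 1 (star T) ∘L R) h1 h2

theorem amp_mem_unitary [CompleteSpace X] [CompleteSpace Y] [CompleteSpace Z] {T : Bd (HT Y Z)}
    (hT : T ∈ unitary (Bd (HT Y Z))) : amp X T ∈ unitary (Bd (HT (HT X Y) Z)) := by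
  rw [Unitary.mem_iff] at *
  rw [star_amp, ← amp_mul, ← amp_mul, hT.1, hT.2, amp_one]
  exact ⟨rfl, rfl⟩

theorem op_one_mem_unitary [CompleteSpace X] [CompleteSpace Y] {T : Bd X}
    (hT : T ∈ unitary (Bd X)) :
    op T (1 : Bd Y) ∈ unitary (Bd (HT X Y)) := by
  rw [Unitary.mem_iff] at *
  rw [star_op, op_mul, op_mul, hT.1, hT.2]
  simp

variable (Y) in
/-- The *-homomorphism `x ↦ x ⊗ I`. -/
def opOneHom [CompleteSpace X] [CompleteSpace Y] : Bd X →⋆ₙₐ[ℂ] Bd (HT X Y) where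
  toFun x := op x 1
  map_smul' c x := map_smul ((opL X X Y Y).flip 1) c x
  map_zero' := map_zero ((opL X X Y Y).flip 1)
  map_add' x y := map_add ((opL X X Y Y).flip 1) x y
  map_mul' x y := by rw [op_mul, one_mul]
  map_star' x := by rw [star_op, star_one]

@[simp] theorem opOneHom_apply [CompleteSpace X] [CompleteSpace Y] (x : Bd X) :
    opOneHom Y x = op x 1 := rfl

theorem opOneHom_injective [CompleteSpace X] [CompleteSpace Y] [Nontrivial Y] :
    Function.Injective (opOneHom Y : Bd X → Bd (HT X Y)) := by
  intro a b h
  obtain ⟨y, hy⟩ := exists_ne (0 : Y)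
  ext x
  have h1 : vec (a x) y = vec (b x) y := by
    simpa using congrArg (fun T => T (vec x y)) h
  have h2 : inner ℂ (vec (a x - b x) y) (vec (a x - b x) y) = 0 := by
    have : vec (a x - b x) y = 0 := by
      rw [sub_eq_add_neg, ← neg_one_smul ℂ (b x), vec_add_left, vec_smul_left, h1]
      simp
    rw [this, inner_zero_left]
  rw [inner_vec, mul_eq_zero, inner_self_eq_zero, inner_self_eq_zero] at h2
  exact sub_eq_zero.1 (h2.resolve_right hy)

/-! ### Slice maps -/

/-- The slice `x ↦ (I ⊗ ⟨η, · ξ⟩)(x)` of operators on `X ⊗ Y`, the compression of `x` to an operator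
on `X` by the maps `v ↦ v ⊗ ξ` and `v ↦ v ⊗ η`. -/
def slice [CompleteSpace X] (ξ η : Y) : Bd (HT X Y) →L[ℂ] Bd X :=
  (ContinuousLinearMap.compL ℂ X (HT X Y) X
      (ContinuousLinearMap.adjoint (vecL.flip η : X →L[ℂ] HT X Y))) ∘L
    ((ContinuousLinearMap.compL ℂ X (HT X Y) (HT X Y)).flip (vecL.flip ξ))

theorem inner_slice [CompleteSpace X] (ξ η : Y) (T : Bd (HT X Y)) (v w : X) :
    inner ℂ w (slice ξ η T v) = inner ℂ (vec w η) (T (vec v ξ)) := by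
  change inner ℂ w (ContinuousLinearMap.adjoint _ (T (vec v ξ))) = _
  rw [ContinuousLinearMap.adjoint_inner_right]
  rfl

theorem slice_op [CompleteSpace X] (ξ η : Y) (a : Bd X) (b : Bd Y) :
    slice ξ η (op a b) = inner ℂ η (b ξ) • a := by
  ext v
  refine ext_inner_left ℂ fun w => ?_
  rw [inner_slice, op_vec, inner_vec]
  simp [inner_smul_right, mul_comm]

theorem slice_mul_op_one [CompleteSpace X] (ξ η : Y) (T : Bd (HT X Y)) (b : Bd Y) :
    slice ξ η (T * op 1 b) = slice (b ξ) η T := by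
  ext v
  refine ext_inner_left ℂ fun w => ?_
  rw [inner_slice, inner_slice]
  simp

end TensorOperators

/-! ### Closed linear spans -/

section ClosedSpan

variable {X Y : Type*} [NormedAddCommGroup X] [InnerProductSpace ℂ X]
  [NormedAddCommGroup Y] [InnerProductSpace ℂ Y]

theorem map_mem_of_mem_closure_span {E F : Type*} [NormedAddCommGroup E] [NormedSpace ℂ E]
    [NormedAddCommGroup F] [NormedSpace ℂ F] {S : Set E} {P : Submodule ℂ F}
    (hP : IsClosed (P : Set F)) (T : E →L[ℂ] F) (h : ∀ s ∈ S, T s ∈ P) {x : E}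
    (hx : x ∈ (Submodule.span ℂ S).topologicalClosure) : T x ∈ P := by
  have hc : IsClosed ((P.comap T.toLinearMap : Submodule ℂ E) : Set E) := hP.preimage T.continuous
  exact hc.closure_subset_iff.2 (Submodule.span_le.2 h) hx

theorem Extends.of_mem {E F : Type*} [NormedAddCommGroup E] [NormedSpace ℂ E]
    [NormedAddCommGroup F] [NormedSpace ℂ F] {gen : Set (E × F)} {p : E × F} (hp : p ∈ gen) :
    Extends gen p.1 p.2 :=
  Submodule.le_topologicalClosure _ (Submodule.subset_span hp)

/-- A continuous linear map which agrees with the prescriptions `gen` on a set `S` agrees with them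
on the closed span of `S`. -/
theorem extends_of_mem_closure_span {E F : Type*} [NormedAddCommGroup E] [NormedSpace ℂ E]
    [NormedAddCommGroup F] [NormedSpace ℂ F] {gen : Set (E × F)} {S : Set E} (T : E →L[ℂ] F)
    (h : ∀ s ∈ S, (s, T s) ∈ gen) {x : E} (hx : x ∈ (Submodule.span ℂ S).topologicalClosure) :
    Extends gen x (T x) :=
  map_mem_of_mem_closure_span (P := (Submodule.span ℂ gen).topologicalClosure)
    (Submodule.isClosed_topologicalClosure _) ((ContinuousLinearMap.id ℂ E).prod T)
    (fun s hs => Extends.of_mem (h s hs)) hx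

/-- The closed algebra generated by `S` is contained in the closed linear span of every set that
contains `S` and is closed under multiplication. -/
theorem mem_closure_span_of_mem_closedAlg {S M : Set (Bd X)} (hSM : S ⊆ M)
    (hM : ∀ a ∈ M, ∀ b ∈ M, a * b ∈ M) {x : Bd X} (hx : x ∈ closedAlg S) :
    x ∈ (Submodule.span ℂ M).topologicalClosure := by
  have hle : ((NonUnitalAlgebra.adjoin ℂ S).toSubmodule : Set (Bd X)) ⊆ Submodule.span ℂ M := by
    rw [NonUnitalAlgebra.adjoin_eq_span]
    refine Submodule.span_mono fun y hy => ?_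
    induction hy using Subsemigroup.closure_induction with
    | mem y hy => exact hSM hy
    | mul y z _ _ hy hz => exact hM y hy z hz
  exact closure_mono hle hx

theorem mem_minTensor_closure_span {A : NonUnitalSubalgebra ℂ (Bd X)}
    {B : NonUnitalSubalgebra ℂ (Bd Y)} {x : Bd (HT X Y)} (hx : x ∈ minTensor A B) :
    x ∈ (Submodule.span ℂ {T | ∃ a ∈ A, ∃ b ∈ B, T = op a b}).topologicalClosure := by
  refine mem_closure_span_of_mem_closedAlg subset_rfl ?_ hx
  rintro _ ⟨a, ha, b, hb, rfl⟩ _ ⟨a', ha', b', hb', rfl⟩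
  exact ⟨_, mul_mem ha ha', _, mul_mem hb hb', op_mul _ _ _ _⟩

theorem op_mem_minTensor {A : NonUnitalSubalgebra ℂ (Bd X)} {B : NonUnitalSubalgebra ℂ (Bd Y)}
    {a : Bd X} {b : Bd Y} (ha : a ∈ A) (hb : b ∈ B) : op a b ∈ minTensor A B :=
  subset_closedAlg _ ⟨a, ha, b, hb, rfl⟩

theorem op_mem_of_mem_closure_span {s : Set (Bd X)} {t : Set (Bd Y)}
    {P : Submodule ℂ (Bd (HT X Y))} (hP : IsClosed (P : Set (Bd (HT X Y))))
    (h : ∀ a ∈ s, ∀ b ∈ t, op a b ∈ P) {a : Bd X} {b : Bd Y}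
    (ha : a ∈ (Submodule.span ℂ s).topologicalClosure)
    (hb : b ∈ (Submodule.span ℂ t).topologicalClosure) : op a b ∈ P :=
  map_mem_of_mem_closure_span hP ((opL X X Y Y).flip b)
    (fun a' ha' => map_mem_of_mem_closure_span hP (opL X X Y Y a') (h a' ha') hb) ha

theorem mem_minTensor_closure_span_of_dense {A : NonUnitalSubalgebra ℂ (Bd X)}
    {B : NonUnitalSubalgebra ℂ (Bd Y)} {s : Set (Bd X)} {t : Set (Bd Y)}
    (hA : ∀ a ∈ A, a ∈ (Submodule.span ℂ s).topologicalClosure)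
    (hB : ∀ b ∈ B, b ∈ (Submodule.span ℂ t).topologicalClosure) {x : Bd (HT X Y)}
    (hx : x ∈ minTensor A B) :
    x ∈ (Submodule.span ℂ {T | ∃ a ∈ s, ∃ b ∈ t, T = op a b}).topologicalClosure := by
  refine map_mem_of_mem_closure_span (Submodule.isClosed_topologicalClosure _)
    (ContinuousLinearMap.id ℂ _) ?_ (mem_minTensor_closure_span hx)
  rintro _ ⟨a, ha, b, hb, rfl⟩
  exact op_mem_of_mem_closure_span
    (P := (Submodule.span ℂ {T | ∃ a ∈ s, ∃ b ∈ t, T = op a b}).topologicalClosure)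
    (Submodule.isClosed_topologicalClosure _) (fun a ha b hb => Submodule.le_topologicalClosure _
      (Submodule.subset_span ⟨a, ha, b, hb, rfl⟩)) (hA a ha) (hB b hb)

theorem mem_groupAlg_closure_span {G : Type*} [Group G] {w : G → Bd X}
    (hw : ∀ g h, w g * w h = w (g * h)) {x : Bd X} (hx : x ∈ groupAlg w) :
    x ∈ (Submodule.span ℂ (Set.range w)).topologicalClosure := by
  refine mem_closure_span_of_mem_closedAlg subset_rfl ?_ hx
  rintro _ ⟨g, rfl⟩ _ ⟨h, rfl⟩
  exact ⟨g * h, (hw g h).symm⟩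

/-- A set of elements of a subalgebra `D` whose closed span contains `D` spans a dense subspace in
the subspace topology of `D`. -/
theorem dense_span_of_subset {D : NonUnitalSubalgebra ℂ (Bd X)} (S : Set D)
    (h : ∀ x ∈ D, x ∈ (Submodule.span ℂ ((↑) '' S : Set (Bd X))).topologicalClosure) :
    Dense (Submodule.span ℂ S : Set D) := by
  rw [Subtype.dense_iff]
  intro x hx
  refine closure_mono ?_ (h x hx)
  have := Submodule.map_span (D.toSubmodule.subtype) S
  intro y hy
  have hy' : y ∈ Submodule.span ℂ ((D.toSubmodule.subtype) '' S) := hy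
  rw [← Submodule.map_span] at hy'
  exact hy'

theorem map_mem_of_dense_span {D F : Type*} [AddCommGroup D] [Module ℂ D] [TopologicalSpace D]
    [NormedAddCommGroup F] [NormedSpace ℂ F] {S : Set D} (hS : Dense (Submodule.span ℂ S : Set D))
    {P : Submodule ℂ F} (hP : IsClosed (P : Set F)) (T : D →L[ℂ] F) (h : ∀ s ∈ S, T s ∈ P)
    (x : D) : T x ∈ P := by
  have hc : IsClosed ((P.comap T.toLinearMap : Submodule ℂ D) : Set D) := hP.preimage T.continuous
  exact hc.closure_subset_iff.2 (Submodule.span_le.2 h) (hS x)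

end ClosedSpan

section Inclusion

variable {X Y : Type*} [NormedAddCommGroup X] [InnerProductSpace ℂ X]
  [NormedAddCommGroup Y] [InnerProductSpace ℂ Y]
  {A : NonUnitalSubalgebra ℂ (Bd X)} {B : NonUnitalSubalgebra ℂ (Bd Y)}

/-- A contractive homomorphism as a continuous linear map into the ambient operators. -/
def contractionL (φ : A →ₙₐ[ℂ] B) (h : ∀ a, ‖(φ a : Bd Y)‖ ≤ ‖(a : Bd X)‖) : A →L[ℂ] Bd Y where
  toFun a := φ a
  map_add' a b := by simp
  map_smul' c a := by simp
  cont := by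
    have : LipschitzWith 1 fun a : A => (φ a : Bd Y) := by
      refine LipschitzWith.of_dist_le_mul fun a b => ?_
      rw [NNReal.coe_one, one_mul, Subtype.dist_eq, dist_eq_norm, dist_eq_norm]
      simpa using h (a - b)
    exact this.continuous

variable (A) in
/-- The inclusion of an operator algebra into the bounded operators. -/
def inclL : A →L[ℂ] Bd X where
  toFun a := a
  map_add' _ _ := rfl
  map_smul' _ _ := rfl
  cont := continuous_subtype_val

@[simp] theorem inclL_apply (a : A) : inclL A a = a := rfl

end Inclusion

/-! ### Completely isometric maps -/

section CompletelyIsometric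

variable {X Y : Type*} [NormedAddCommGroup X] [InnerProductSpace ℂ X] [CompleteSpace X]
  [NormedAddCommGroup Y] [InnerProductSpace ℂ Y] [CompleteSpace Y]
  {A : NonUnitalSubalgebra ℂ (Bd X)} {B : NonUnitalSubalgebra ℂ (Bd Y)}

/-- The restriction of an injective *-homomorphism is completely isometric: its amplifications are
restrictions of injective *-homomorphisms between C*-algebras of matrices. -/
theorem completelyIsometric_of_starHom (θ : Bd X →⋆ₙₐ[ℂ] Bd Y) (hθ : Function.Injective θ)
    (φ : A →ₙₐ[ℂ] B) (h : ∀ a, (φ a : Bd Y) = θ a) : CompletelyIsometric φ := by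
  intro n m
  have hinj : Function.Injective (CStarMatrix.mapₙₐ (n := Fin n) θ) := by
    intro M N hMN
    ext1 i j
    exact hθ (congrFun (congrFun hMN i) j)
  rw [← NonUnitalStarAlgHom.norm_map _ hinj]
  congr 1
  ext1 i j
  exact h (m i j)

theorem norm_ofMatrix_one (a : Bd X) :
    ‖CStarMatrix.ofMatrix (fun _ _ : Fin 1 => a)‖ = ‖a‖ := by
  let θ : Bd X →⋆ₙₐ[ℂ] CStarMatrix (Fin 1) (Fin 1) (Bd X) :=
    { toFun := fun a => CStarMatrix.ofMatrix fun _ _ => a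
      map_smul' := fun c a => rfl
      map_zero' := rfl
      map_add' := fun a b => rfl
      map_mul' := fun a b => by ext1; simp [CStarMatrix.mul_apply]; rfl
      map_star' := fun a => by ext1; simp [CStarMatrix.star_apply]; rfl }
  have hθ : Function.Injective θ := fun a b h => congrFun (congrFun h 0) 0
  have := NonUnitalStarAlgHom.norm_map θ hθ a
  exact this

theorem CompletelyContractive.norm_le {φ : A →ₙₐ[ℂ] B} (h : CompletelyContractive φ) (a : A) :
    ‖(φ a : Bd Y)‖ ≤ ‖(a : Bd X)‖ := by
  rw [← norm_ofMatrix_one (φ a : Bd Y), ← norm_ofMatrix_one (a : Bd X)]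
  exact h 1 fun _ _ => a

theorem CompletelyIsometric.norm_eq {φ : A →ₙₐ[ℂ] B} (h : CompletelyIsometric φ) (a : A) :
    ‖(φ a : Bd Y)‖ = ‖(a : Bd X)‖ := by
  rw [← norm_ofMatrix_one (φ a : Bd Y), ← norm_ofMatrix_one (a : Bd X)]
  exact h 1 fun _ _ => a

/-- A *-homomorphism between algebras of operators as a continuous linear map. -/
def starHomL (θ : Bd X →⋆ₙₐ[ℂ] Bd Y) (hθ : Function.Injective θ) : Bd X →L[ℂ] Bd Y where
  toFun := θ
  map_add' := map_add θ
  map_smul' := map_smul θ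
  cont := (NonUnitalStarAlgHom.isometry θ hθ).continuous

@[simp] theorem starHomL_apply (θ : Bd X →⋆ₙₐ[ℂ] Bd Y) (hθ : Function.Injective θ) (x : Bd X) :
    starHomL θ hθ x = θ x := rfl

/-- Conjugation `x ↦ u x u*` by a unitary `u`. -/
def conjHom (u : unitary (Bd X)) : Bd X →⋆ₙₐ[ℂ] Bd X where
  toFun x := u * x * star (u : Bd X)
  map_smul' c x := by simp
  map_zero' := by simp
  map_add' x y := by simp [mul_add, add_mul]
  map_mul' x y := by
    have h : star (u : Bd X) * u = 1 := Unitary.coe_star_mul_self u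
    calc (u : Bd X) * (x * y) * star (u : Bd X)
        = u * x * 1 * y * star (u : Bd X) := by simp only [mul_one, mul_assoc]
      _ = u * x * star (u : Bd X) * (u * y * star (u : Bd X)) := by
        rw [← h]; simp only [mul_assoc]
  map_star' x := by simp [mul_assoc]

@[simp] theorem conjHom_apply (u : unitary (Bd X)) (x : Bd X) :
    conjHom u x = u * x * star (u : Bd X) := rfl

theorem conjHom_star_conjHom (u : unitary (Bd X)) (x : Bd X) :
    conjHom (star u) (conjHom u x) = x := by
  have h : star (u : Bd X) * u = 1 := Unitary.coe_star_mul_self u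
  calc _ = (star (u : Bd X) * u) * x * (star (u : Bd X) * u) := by
        simp only [conjHom_apply, Unitary.coe_star, star_star, mul_assoc]
    _ = x := by rw [h]; simp

theorem conjHom_conjHom_star (u : unitary (Bd X)) (x : Bd X) :
    conjHom u (conjHom (star u) x) = x := by
  simpa using conjHom_star_conjHom (star u) x

theorem conjHom_injective (u : unitary (Bd X)) : Function.Injective (conjHom u) :=
  Function.LeftInverse.injective (conjHom_star_conjHom u)

end CompletelyIsometric

/-! ### Compact operators on `ℓ²` -/

section Compacts

open InnerProductSpace

variable {ι : Type*}

theorem rankOne_mem_compacts {X : Type*} [NormedAddCommGroup X] [InnerProductSpace ℂ X] (x y : X) :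
    rankOne ℂ x y ∈ compacts X := by
  change IsCompactOperator (rankOne ℂ x y)
  rw [rankOne_def']
  exact (isCompactOperator_of_locallyCompactSpace_rng
    (ContinuousLinearMap.toSpanSingleton ℂ x)).comp_clm (innerSL ℂ y)

theorem isClosed_compacts {X : Type*} [NormedAddCommGroup X] [InnerProductSpace ℂ X]
    [CompleteSpace X] : IsClosed (compacts X : Set (Bd X)) :=
  isClosed_setOfPred_isCompactOperator

theorem inner_e (i : ι) (ξ : L2 ι) : inner ℂ (e i) ξ = ξ i := by
  classical
  rw [e, lp.inner_single_left]
  simp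

theorem inner_e_e [DecidableEq ι] (i j : ι) :
    inner ℂ (e i : L2 ι) (e j) = if i = j then 1 else 0 :=
  orthonormal_iff_ite.1 orthonormal_e i j

theorem norm_sub_sum_e_le (s : Finset ι) (ξ : L2 ι) : ‖ξ - ∑ i ∈ s, ξ i • e i‖ ≤ ‖ξ‖ := by
  classical
  have h := lp.norm_compl_sum_single (E := fun _ : ι => ℂ) (p := 2) (by simp) ξ s
  have h1 : ∑ i ∈ s, ξ i • (e i : L2 ι) = ∑ i ∈ s, lp.single 2 i (ξ i) :=
    Finset.sum_congr rfl fun i _ => by simp [e, ← lp.single_smul]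
  rw [h1]
  refine (Real.rpow_le_rpow_iff (norm_nonneg _) (norm_nonneg _)
    (z := (2 : ℝ≥0∞).toReal) (by simp)).1 ?_
  rw [h]
  exact sub_le_self _ (Finset.sum_nonneg fun i _ => by positivity)

theorem tendsto_sum_e (ξ : L2 ι) :
    Filter.Tendsto (fun s : Finset ι => ∑ i ∈ s, ξ i • (e i : L2 ι)) Filter.atTop (𝓝 ξ) := by
  classical
  have h := lp.hasSum_single (E := fun _ : ι => ℂ) (p := 2) (by simp) ξ
  refine Filter.Tendsto.congr (fun s => ?_) h
  exact Finset.sum_congr rfl fun i _ => by simp [e, ← lp.single_smul]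

/-- The matrix units span a dense subspace of the compact operators. Indeed a compact operator `T`
is the norm limit of its compressions `P T` to finitely many coordinates, since `P → 1` uniformly on
the relatively compact image of the unit ball. -/
theorem mem_compacts_closure_span {T : Bd (L2 ι)} (hT : T ∈ compacts (L2 ι)) :
    T ∈ (Submodule.span ℂ
      {k | ∃ i j : ι, k = rankOne ℂ (e i : L2 ι) (e j : L2 ι)}).topologicalClosure := by
  classical
  set P := (Submodule.span ℂ
      {k | ∃ i j : ι, k = rankOne ℂ (e i : L2 ι) (e j : L2 ι)}).topologicalClosure with hP
  have hPc : IsClosed (P : Set (Bd (L2 ι))) := Submodule.isClosed_topologicalClosure _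
  have h1 : ∀ (i : ι) (η : L2 ι), rankOne ℂ (e i : L2 ι) η ∈ P := by
    intro i η
    have hc : IsClosed ((P.comap (rankOne ℂ (e i : L2 ι)).toLinearMap : Submodule ℂ (L2 ι))
        : Set (L2 ι)) := hPc.preimage (rankOne ℂ (e i : L2 ι)).continuous
    refine hc.closure_subset_iff.2 (Submodule.span_le.2 ?_) (dense_span_e η)
    rintro _ ⟨j, rfl⟩
    exact Submodule.le_topologicalClosure _ (Submodule.subset_span ⟨i, j, rfl⟩)
  have h2 : ∀ s : Finset ι, (∑ i ∈ s, rankOne ℂ (e i : L2 ι) (e i)) ∘L T ∈ P := by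
    intro s
    rw [ContinuousLinearMap.finsetSum_comp]
    refine sum_mem fun i _ => ?_
    rw [rankOne_comp]
    exact h1 _ _
  have happ : ∀ (s : Finset ι) (ξ : L2 ι),
      (∑ i ∈ s, rankOne ℂ (e i : L2 ι) (e i)) ξ = ∑ i ∈ s, ξ i • (e i : L2 ι) := by
    intro s ξ
    rw [sum_apply]
    exact Finset.sum_congr rfl fun i _ => by rw [rankOne_apply, inner_e]
  refine hPc.closure_subset (Metric.mem_closure_iff.2 fun ε hε => ?_)
  obtain ⟨K, hK, hTK⟩ := IsCompactOperator.image_closedBall_subset_compact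
    (f := (T : L2 ι →ₗ[ℂ] L2 ι)) hT 1
  obtain ⟨t, ht, hKt⟩ := Metric.totallyBounded_iff.1 hK.totallyBounded (ε / 4) (by positivity)
  have h3 : ∀ᶠ s : Finset ι in Filter.atTop, ∀ y ∈ t,
      dist (∑ i ∈ s, y i • (e i : L2 ι)) y < ε / 4 :=
    (Filter.eventually_all_finite ht).2 fun y _ =>
      Metric.tendsto_nhds.1 (tendsto_sum_e y) (ε / 4) (by positivity)
  obtain ⟨s, hs⟩ := h3.exists
  refine ⟨_, h2 s, ?_⟩
  rw [dist_eq_norm]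
  refine lt_of_le_of_lt (b := ε / 2) ?_ (by linarith)
  refine ContinuousLinearMap.opNorm_le_of_unit_norm (by positivity) fun x hx => ?_
  have hxK : T x ∈ K := hTK ⟨x, by simp [hx], rfl⟩
  obtain ⟨y, hy, hxy⟩ := Set.mem_iUnion₂.1 (hKt hxK)
  have h4 : (T - (∑ i ∈ s, rankOne ℂ (e i : L2 ι) (e i)) ∘L T) x =
      ((T x - y) - ∑ i ∈ s, (T x - y) i • (e i : L2 ι)) + (y - ∑ i ∈ s, y i • (e i : L2 ι)) := by
    change T x - (∑ i ∈ s, rankOne ℂ (e i : L2 ι) (e i)) (T x) = _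
    rw [← happ, ← happ, map_sub]
    abel
  rw [h4]
  have h5 := norm_sub_sum_e_le s (T x - y)
  have h6 := hs y hy
  rw [dist_comm, dist_eq_norm] at h6
  rw [Metric.mem_ball, dist_eq_norm] at hxy
  calc _ ≤ _ := norm_add_le _ _
    _ ≤ ε / 4 + ε / 4 := add_le_add (h5.trans hxy.le) h6.le
    _ = ε / 2 := by ring

theorem mulOp_e (f : lp (fun _ : ι => ℂ) ∞) (j : ι) : mulOp f (e j) = f j • e j := by
  ext i
  rw [mulOp_apply]
  by_cases hij : i = j
  · subst hij; simp
  · simp [e, hij]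

/-- Multiplication by a function that vanishes at infinity is a norm limit of finite rank
operators. -/
theorem mulOp_mem_compacts {f : lp (fun _ : ι => ℂ) ∞}
    (hf : Filter.Tendsto (fun i => f i) Filter.cofinite (𝓝 0)) : mulOp f ∈ compacts (L2 ι) := by
  classical
  refine isClosed_compacts.closure_subset (Metric.mem_closure_iff.2 fun ε hε => ?_)
  have h1 : ∀ᶠ i in Filter.cofinite, ‖f i‖ < ε / 2 := by
    have := Metric.tendsto_nhds.1 hf (ε / 2) (by positivity)
    simpa using this
  have hfin : {i | ¬ ‖f i‖ < ε / 2}.Finite := h1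
  let s := hfin.toFinset
  let f' : lp (fun _ : ι => ℂ) ∞ := ⟨fun i => if i ∈ s then 0 else f i, memℓp_infty ⟨‖f‖, by
    rintro _ ⟨i, rfl⟩
    dsimp only
    split_ifs
    · simp
    · exact lp.norm_apply_le_norm (by simp) f i⟩⟩
  have hf' : ‖f'‖ ≤ ε / 2 := by
    refine lp.norm_le_of_forall_le (by positivity) fun i => ?_
    change ‖if i ∈ s then (0 : ℂ) else f i‖ ≤ _
    split_ifs with hi
    · simpa using by positivity
    · have : ‖f i‖ < ε / 2 := by simpa [s] using hi
      exact this.le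
  refine ⟨∑ i ∈ s, f i • rankOne ℂ (e i : L2 ι) (e i),
    sum_mem fun i _ => (compacts (L2 ι)).smul_mem _ (rankOne_mem_compacts _ _), ?_⟩
  have h2 : mulOp f - ∑ i ∈ s, f i • rankOne ℂ (e i : L2 ι) (e i) = mulOp f' := by
    refine ContinuousLinearMap.ext_on dense_span_e ?_
    rintro _ ⟨j, rfl⟩
    have h4 : f' j = if j ∈ s then 0 else f j := rfl
    rw [sub_apply, mulOp_e, mulOp_e, h4, sum_apply]
    simp only [smul_apply, rankOne_apply, inner_e_e]
    by_cases hj : j ∈ s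
    · simp [hj]
    · simp [hj]
  rw [dist_eq_norm, h2]
  refine lt_of_le_of_lt ?_ (half_lt_self hε)
  exact (lp.norm_mapCLM_le _ _ _ _).trans hf'

end Compacts

/-! ### The comultiplication of the reduced group C*-algebra -/

section Comult

variable {G : Type*} [Group G]

@[simp] theorem lam_e (g h : G) : lam g (e h) = e (g * h) := perm_e _ _

@[simp] theorem lam_one : lam (1 : G) = 1 :=
  ContinuousLinearMap.ext_on dense_span_e (by rintro _ ⟨h, rfl⟩; simp)

theorem lam_mul (g h : G) : lam g * lam h = lam (g * h) :=
  ContinuousLinearMap.ext_on dense_span_e (by rintro _ ⟨k, rfl⟩; simp [mul_assoc])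

theorem lam_mem_CRed (g : G) : lam g ∈ CRed G := subset_closedAlg _ ⟨g, rfl⟩

theorem unitaryOp_mem_unitary {X : Type*} [NormedAddCommGroup X] [InnerProductSpace ℂ X]
    [CompleteSpace X] (W : X ≃ₗᵢ[ℂ] X) : unitaryOp W ∈ unitary (Bd X) := by
  have h : star (unitaryOp W) = unitaryOp W.symm := LinearIsometryEquiv.star_eq_symm W
  rw [Unitary.mem_iff, h]
  constructor <;> ext x <;> simp

theorem onPair_unitaryOp_mem_unitary {ι κ : Type*} (W : L2 (ι × κ) ≃ₗᵢ[ℂ] L2 (ι × κ)) :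
    onPair (unitaryOp W) ∈ unitary (Bd (HT (L2 ι) (L2 κ))) :=
  unitaryOp_mem_unitary (((prodEquiv ι κ).trans W).trans (prodEquiv ι κ).symm)

variable (G) in
theorem U_mem_unitary : U G ∈ unitary (Bd (HT (L2 G) (L2 G))) := onPair_unitaryOp_mem_unitary _

variable (G) in
theorem S_mem_unitary : S G ∈ unitary (Bd (HT (L2 G) (L2 G))) := onPair_unitaryOp_mem_unitary _

variable {X : Type*} [NormedAddCommGroup X] [InnerProductSpace ℂ X]

theorem amp_U_vec (x : X) (g h : G) :
    amp X (U G) (vec (vec x (e g)) (e h)) = vec (vec x (e g)) (e (g * h)) := by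
  rw [amp_vec, U_vec, assoc_symm_vec]

variable [CompleteSpace X]

variable (G X) in
/-- The unitary `I ⊗ U` on `X ⊗ ℓ²(G) ⊗ ℓ²(G)`. -/
def ampU : unitary (Bd (HT (HT X (L2 G)) (L2 G))) :=
  ⟨amp X (U G), amp_mem_unitary (U_mem_unitary G)⟩

variable (G X) in
/-- The *-homomorphism `x ↦ (I ⊗ U)(x ⊗ I)(I ⊗ U)*`. It restricts to `id ⊗ Δ_λ` on operators of the
form `a ⊗ c` with `c ∈ C*_λ(G)`. -/
def comult : Bd (HT X (L2 G)) →⋆ₙₐ[ℂ] Bd (HT (HT X (L2 G)) (L2 G)) :=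
  (conjHom (ampU G X)).comp (opOneHom (L2 G))

theorem comult_apply (x : Bd (HT X (L2 G))) :
    comult G X x = amp X (U G) * op x 1 * amp X (star (U G)) := by
  rw [← star_amp]; rfl

instance : Nontrivial (L2 G) :=
  ⟨e 1, 0, (orthonormal_e (ι := G)).ne_zero 1⟩

theorem comult_injective : Function.Injective (comult G X) :=
  (conjHom_injective _).comp opOneHom_injective

theorem comult_eq_of_mul_eq {x : Bd (HT X (L2 G))} {y : Bd (HT (HT X (L2 G)) (L2 G))}
    (h : amp X (U G) * op x 1 = y * amp X (U G)) : comult G X x = y := by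
  rw [comult_apply, h, mul_assoc, ← star_amp,
    Unitary.mul_star_self_of_mem (amp_mem_unitary (U_mem_unitary G)), mul_one]

theorem comult_op_lam (a : Bd X) (g : G) :
    comult G X (op a (lam g)) = op (op a (lam g)) (lam g) :=
  comult_eq_of_mul_eq <| clm_ext_vec_e_e fun x h t => by
    simp [amp_U_vec, mul_assoc]

end Comult

/-! ### Reduced coactions from gradings -/

section Grading

variable {G : Type*} [Group G] {X : Type*} [NormedAddCommGroup X] [InnerProductSpace ℂ X]
  [CompleteSpace X]

/-- The elements of `D` on which `ε` has the form `d ↦ d ⊗ w_g` for some `g`. -/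
def homogeneous {K : Type*} [NormedAddCommGroup K] [InnerProductSpace ℂ K] (w : G → Bd K)
    {D : NonUnitalSubalgebra ℂ (Bd X)} (ε : D →ₙₐ[ℂ] minTensor D (groupAlg w)) : Set D :=
  {d | ∃ g, (ε d : Bd (HT X K)) = op (d : Bd X) (w g)}

/-- A completely isometric homomorphism `ε : D → D ⊗ C*_λ(G)` for which the homogeneous elements
span a dense subspace of `D` is a reduced coaction: for a homogeneous element the coaction identity
and nondegeneracy are evident. -/
theorem isReducedCoaction_of_dense_homogeneous {D : NonUnitalSubalgebra ℂ (Bd X)}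
    (ε : D →ₙₐ[ℂ] minTensor D (CRed G)) (hε : CompletelyIsometric ε)
    (hD : Dense (Submodule.span ℂ (homogeneous lam ε) : Set D)) : IsReducedCoaction D ε := by
  let εL := contractionL ε fun a => (hε.norm_eq a).le
  refine ⟨⟨fun a => ⟨comult G X (ε a), ?_, ?_⟩, le_antisymm ?_ ?_⟩, hε⟩
  · refine map_mem_of_dense_span hD (Submodule.isClosed_topologicalClosure _)
      (εL.prod (starHomL (comult G X) comult_injective ∘L εL)) ?_ a
    rintro d ⟨g, hd⟩
    refine Submodule.le_topologicalClosure _ (Submodule.subset_span ⟨d, lam g, lam_mem_CRed g, ?_⟩)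
    change ((ε d : Bd (HT X (L2 G))), comult G X (ε d)) = _
    rw [hd, comult_op_lam]
  · refine map_mem_of_dense_span hD (Submodule.isClosed_topologicalClosure _)
      (εL.prod (starHomL (comult G X) comult_injective ∘L εL)) ?_ a
    rintro d ⟨g, hd⟩
    refine Submodule.le_topologicalClosure _ (Submodule.subset_span ⟨d, g, ?_⟩)
    change ((ε d : Bd (HT X (L2 G))), comult G X (ε d)) = _
    rw [hd, comult_op_lam]
  · refine Submodule.topologicalClosure_minimal _ (Submodule.span_le.2 ?_) (isClosed_minTensor _ _)
    rintro _ ⟨a, c, hc, rfl⟩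
    refine map_mem_of_mem_closure_span (P := (minTensor D (CRed G)).toSubmodule)
      (isClosed_minTensor _ _)
      ((ContinuousLinearMap.mul ℂ (Bd (HT X (L2 G)))).flip (op 1 c)) ?_
      (mem_minTensor_closure_span (ε a).2)
    rintro _ ⟨b, hb, c', hc', rfl⟩
    change op b c' * op 1 c ∈ minTensor D (CRed G)
    rw [op_mul, mul_one]
    exact op_mem_minTensor hb (mul_mem hc' hc)
  · intro x hx
    refine map_mem_of_mem_closure_span (Submodule.isClosed_topologicalClosure _)
      (ContinuousLinearMap.id ℂ _) ?_ (mem_minTensor_closure_span hx)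
    rintro _ ⟨a, ha, c, hc, rfl⟩
    refine map_mem_of_dense_span hD (Submodule.isClosed_topologicalClosure _)
      ((opL X X (L2 G) (L2 G)).flip c ∘L inclL D) ?_ ⟨a, ha⟩
    rintro d ⟨g, hd⟩
    refine Submodule.le_topologicalClosure _ (Submodule.subset_span
      ⟨d, lam g⁻¹ * c, mul_mem (lam_mem_CRed _) hc, ?_⟩)
    rw [hd, op_mul, ← mul_assoc, lam_mul]
    simp

end Grading

/-! ### Spectral decomposition of a coaction -/

section Spectral

variable {G : Type*} [Group G] {H : Type*} [NormedAddCommGroup H] [InnerProductSpace ℂ H]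

theorem univ_jVec (g h : G) : univ g (jVec h) = jVec (g * h) := by
  have := congrArg (fun T => T (e h)) (univ_comp_jL g)
  rw [← jLam_e, ← jLam_e, ← lam_e]
  exact this

theorem univ_mul (g h : G) : univ g * univ h = univ (g * h) := by
  ext1 ξ
  ext1
  funext π
  change univ g (univ h ξ) π = _
  rw [univ_apply, univ_apply, univ_apply, map_mul]
  rfl

theorem dlam_apply_of_eq {A : NonUnitalSubalgebra ℂ (Bd H)} {δ : A →ₙₐ[ℂ] minTensor A (CFull G)}
    {a : A} {g : G} (h : (δ a : Bd (HT H (HU G))) = op (a : Bd H) (univ g)) :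
    (dlam δ a : Bd (HT H (L2 G))) = op (a : Bd H) (lam g) := by
  rw [← idTensorLam_op A a a.2 g]
  change ((idTensorLam G A (δ a) : minTensor A (CRed G)) : Bd (HT H (L2 G))) = _
  congr 2
  exact Subtype.ext h

theorem slice_mul_op_one_mem {X Y : Type*} [NormedAddCommGroup X] [InnerProductSpace ℂ X]
    [CompleteSpace X] [NormedAddCommGroup Y] [InnerProductSpace ℂ Y] {t : Set (Bd Y)}
    {P : Submodule ℂ (Bd X)} (hP : IsClosed (P : Set (Bd X))) {ξ η : Y} {T : Bd (HT X Y)}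
    (h : ∀ b ∈ t, slice (b ξ) η T ∈ P) {c : Bd Y}
    (hc : c ∈ (Submodule.span ℂ t).topologicalClosure) : slice ξ η (T * op 1 c) ∈ P :=
  map_mem_of_mem_closure_span hP
    (slice ξ η ∘L (ContinuousLinearMap.mul ℂ (Bd (HT X Y)) T ∘L opL X X Y Y 1))
    (fun b hb => (slice_mul_op_one ξ η T b).symm ▸ h b hb) hc

variable [CompleteSpace H] {A : NonUnitalSubalgebra ℂ (Bd H)}
  {K : Type*} [NormedAddCommGroup K] [InnerProductSpace ℂ K] {w : G → Bd K} {ξ : G → K}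

/-- Let `ξ` be an orthonormal family with `w_g ξ_h = ξ_{gh}`. Applying `id ⊗ χ` to `ε(a)`, where `χ`
is the functional `c ↦ ⟨ξ_1, c ξ_g⟩`, so that `χ(w_h) = 1` for `h = g⁻¹` and `χ(w_h) = 0` otherwise,
gives a homogeneous element of degree `g⁻¹`. -/
theorem CoactionAxioms.exists_homogeneous_eq_slice (hA : IsClosed (A : Set (Bd H)))
    {ε : A →ₙₐ[ℂ] minTensor A (groupAlg w)} (hε : CoactionAxioms w A ε)
    (hle : ∀ a, ‖(ε a : Bd (HT H K))‖ ≤ ‖(a : Bd H)‖) (hξ : Orthonormal ℂ ξ)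
    (hwξ : ∀ g h, w g (ξ h) = ξ (g * h)) (a : A) (g : G) :
    ∃ b : A, (b : Bd H) = slice (ξ g) (ξ 1) (ε a : Bd (HT H K)) ∧
      (ε b : Bd (HT H K)) = op (b : Bd H) (w g⁻¹) := by
  classical
  obtain ⟨y, hy₁, hy₂⟩ := hε.coaction_identity a
  let graph : A →L[ℂ] Bd H × Bd (HT H K) := (inclL A).prod (contractionL ε hle)
  have hgraph : ∀ b : A, graph b = ((b : Bd H), (ε b : Bd (HT H K))) := fun b => rfl
  have hclosed : IsClosed (LinearMap.range graph.toLinearMap : Set (Bd H × Bd (HT H K))) := by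
    have : CompleteSpace A := hA.completeSpace_coe
    have hanti : AntilipschitzWith 1 graph := AntilipschitzWith.of_le_mul_dist fun b c => by
      rw [NNReal.coe_one, one_mul]
      exact le_max_left _ _
    exact hanti.isClosed_range graph.uniformContinuous
  have h1 := map_mem_of_mem_closure_span hclosed
    ((slice (X := H) (ξ g) (ξ 1)).prodMap (slice (X := HT H K) (ξ g) (ξ 1)))
    (by
      rintro _ ⟨b, c, -, rfl⟩
      refine ⟨inner ℂ (ξ 1) (c (ξ g)) • b, ?_⟩
      refine (map_smul graph _ b).trans ?_
      rw [hgraph]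
      exact Prod.ext (slice_op _ _ _ _).symm (slice_op _ _ _ _).symm) hy₁
  have h2 := map_mem_of_mem_closure_span (P := ⊥) isClosed_singleton
    (slice (X := HT H K) (ξ g) (ξ 1) ∘L ContinuousLinearMap.snd ℂ (Bd (HT H K)) _ -
      (opL H H K K).flip (w g⁻¹) ∘L slice (X := H) (ξ g) (ξ 1) ∘L
        ContinuousLinearMap.fst ℂ _ (Bd (HT (HT H K) K)))
    (S := {p | ∃ (b : A) (g : G), p = (op (b : Bd H) (w g), op (op (b : Bd H) (w g)) (w g))})
    (by
      rintro _ ⟨b, h, rfl⟩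
      simp only [Submodule.mem_bot, sub_apply, ContinuousLinearMap.comp_apply,
        ContinuousLinearMap.coe_snd', ContinuousLinearMap.coe_fst', slice_op, map_smul,
        ContinuousLinearMap.flip_apply, opL_apply]
      rw [hwξ, orthonormal_iff_ite.1 hξ]
      split_ifs with hgh
      · rw [eq_inv_of_mul_eq_one_left hgh.symm, sub_self]
      · simp) hy₂
  obtain ⟨b, hb⟩ := h1
  have hb1 : (b : Bd H) = slice (ξ g) (ξ 1) (ε a : Bd (HT H K)) := congrArg Prod.fst hb
  have hb2 : (ε b : Bd (HT H K)) = slice (ξ g) (ξ 1) y := congrArg Prod.snd hb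
  refine ⟨b, hb1, ?_⟩
  rw [hb2, hb1]
  exact sub_eq_zero.1 h2

/-- The homogeneous elements of a coaction span a dense subspace. This is where nondegeneracy is
used: slicing the elements `ε(a)(I ⊗ w_g)`, which span a dense subspace of `A ⊗ C*_w`, produces
homogeneous elements. -/
theorem CoactionAxioms.dense_homogeneous (hA : IsClosed (A : Set (Bd H)))
    {ε : A →ₙₐ[ℂ] minTensor A (groupAlg w)} (hε : CoactionAxioms w A ε)
    (hle : ∀ a, ‖(ε a : Bd (HT H K))‖ ≤ ‖(a : Bd H)‖) (hξ : Orthonormal ℂ ξ)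
    (hwξ : ∀ g h, w g (ξ h) = ξ (g * h)) (hw : ∀ g h, w g * w h = w (g * h)) :
    Dense (Submodule.span ℂ (homogeneous w ε) : Set A) := by
  classical
  refine dense_span_of_subset _ fun x hx => ?_
  set P := (Submodule.span ℂ ((↑) '' homogeneous w ε : Set (Bd H))).topologicalClosure
  have hP : IsClosed (P : Set (Bd H)) := Submodule.isClosed_topologicalClosure _
  have h1 : op x (w 1) ∈ (minTensor A (groupAlg w)).toSubmodule :=
    op_mem_minTensor hx (subset_closedAlg _ ⟨1, rfl⟩)
  rw [← hε.nondegenerate] at h1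
  have h2 := map_mem_of_mem_closure_span hP (slice (ξ 1) (ξ 1)) ?_ h1
  · rw [slice_op, hwξ, one_mul, orthonormal_iff_ite.1 hξ] at h2
    simpa using h2
  rintro _ ⟨a, c, hc, rfl⟩
  refine slice_mul_op_one_mem hP ?_ (mem_groupAlg_closure_span hw hc)
  rintro _ ⟨g, rfl⟩
  rw [hwξ, mul_one]
  obtain ⟨b, hb, hb'⟩ := hε.exists_homogeneous_eq_slice hA hle hξ hwξ a g
  exact Submodule.le_topologicalClosure _ (Submodule.subset_span ⟨b, ⟨g⁻¹, hb'⟩, hb⟩)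

theorem IsCoaction.dense_homogeneous (hA : IsClosed (A : Set (Bd H)))
    {δ : A →ₙₐ[ℂ] minTensor A (CFull G)} (hδ : IsCoaction A δ) :
    Dense (Submodule.span ℂ (homogeneous univ δ) : Set A) :=
  hδ.toCoactionAxioms.dense_homogeneous hA hδ.completelyContractive.norm_le orthonormal_jVec
    univ_jVec univ_mul

end Spectral

/-! ### Conjugation by `V` -/

section ConjV

open InnerProductSpace

variable {ι κ : Type*}

theorem onPair_mulOp_vec (F : lp (fun _ : ι × κ => ℂ) ∞) (i : ι) (j : κ) :
    onPair (mulOp F) (vec (e i) (e j)) = F (i, j) • vec (e i) (e j) := by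
  change (prodEquiv ι κ).symm (mulOp F (prodEquiv ι κ (vec (e i) (e j)))) = _
  rw [LinearIsometryEquiv.symm_apply_eq, map_smul, prodEquiv_vec, mulOp_e]

/-- The characteristic function of a point, as an element of `ℓ^∞`. -/
def pointFun (h : ι) : lp (fun _ : ι => ℂ) ∞ := by
  classical exact lp.single ∞ h 1

theorem pointFun_apply [DecidableEq ι] (h k : ι) : pointFun h k = if k = h then 1 else 0 := by
  classical
  simp [pointFun, Pi.single_apply]

theorem pointFun_mem_c0 (h : ι) : pointFun h ∈ c0 ι := by
  classical
  refine tendsto_const_nhds.congr' ?_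
  filter_upwards [(Set.finite_singleton h).compl_mem_cofinite] with k hk
  rw [pointFun_apply, if_neg (show k ≠ h from hk)]

variable {G : Type*} [Group G] {H : Type*} [NormedAddCommGroup H] [InnerProductSpace ℂ H]

theorem amp_US_vec (x : H) (g h : G) :
    amp H (U G * S G) (vec (vec x (e g)) (e h)) = vec (vec x (e g)) (e (g * h⁻¹)) := by
  rw [amp_vec]
  change (assoc _ _ _).symm (vec x (U G (S G _))) = _
  rw [S_vec, U_vec, assoc_symm_vec]

theorem kc0_vec (f : lp (fun _ : G => ℂ) ∞) (x : H) (g h : G) :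
    kc0 H f (vec (vec x (e g)) (e h)) = f (g * h⁻¹) • vec (vec x (e g)) (e h) := by
  rw [kc0, amp_vec, onPair_mulOp_vec, vec_smul_right, map_smul, assoc_symm_vec]
  rfl

/-- The right regular representation, `ρ_g e_h = e_{h g⁻¹}`. -/
def rho (g : G) : Bd (L2 G) := unitaryOp (perm (Equiv.mulRight g⁻¹))

@[simp] theorem rho_e (g h : G) : rho g (e h) = e (h * g⁻¹) := perm_e _ _

/-- For fixed `s`, the operators `λ_s M_f ρ_r` with `f` the characteristic function of a point are
all the matrix units. -/
theorem lam_mul_mulOp_mul_rho (s p q : G) :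
    lam s * mulOp (pointFun (s⁻¹ * p)) * rho (p⁻¹ * s * q) =
      rankOne ℂ (e p : L2 G) (e q : L2 G) := by
  classical
  refine ContinuousLinearMap.ext_on dense_span_e ?_
  rintro _ ⟨k, rfl⟩
  change lam s (mulOp _ (rho _ (e k))) = _
  rw [rho_e, mulOp_e, pointFun_apply, map_smul, lam_e, rankOne_apply, inner_e_e]
  have hiff : k * (p⁻¹ * s * q)⁻¹ = s⁻¹ * p ↔ q = k := by
    rw [mul_inv_eq_iff_eq_mul]
    constructor
    · rintro rfl; group
    · rintro rfl; group
  by_cases hk : q = k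
  · rw [if_pos (hiff.2 hk), if_pos hk, hiff.2 hk]
    simp
  · rw [if_neg fun h => hk (hiff.1 h), if_neg hk]
    simp

/-- On a generator of the double crossed product with group element `g`, the double dual coaction is
`z ↦ z ⊗ λ_g`. -/
theorem comult_gen {A : NonUnitalSubalgebra ℂ (Bd H)} (δ : A →ₙₐ[ℂ] minTensor A (CFull G))
    (a : A) (f : lp (fun _ : G => ℂ) ∞) (g : G) :
    comult G (HT H (L2 G)) (kA δ a * kc0 H f * kG H g) =
      op (kA δ a * kc0 H f * kG H g) (lam g) := by
  have h1 : comult G (HT H (L2 G)) (kA δ a) = op (kA δ a) 1 := by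
    have := comult_op_lam (dlam δ a : Bd (HT H (L2 G))) (1 : G)
    rwa [lam_one] at this
  have h2 : comult G (HT H (L2 G)) (kc0 H f) = op (kc0 H f) 1 := by
    refine comult_eq_of_mul_eq <| clm_ext_vec_e fun z t => ?_
    have : (amp (HT H (L2 G)) (U G) * op (kc0 H f) 1) ∘L vecL.flip (e t) =
        (op (kc0 H f) 1 * amp (HT H (L2 G)) (U G)) ∘L vecL.flip (e t) := by
      refine clm_ext_vec_e_e fun x g h => ?_
      change amp (HT H (L2 G)) (U G) (op (kc0 H f) 1 (vec (vec (vec x (e g)) (e h)) (e t))) =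
        op (kc0 H f) 1 (amp (HT H (L2 G)) (U G) (vec (vec (vec x (e g)) (e h)) (e t)))
      rw [amp_U_vec, op_vec, op_vec, kc0_vec, vec_smul_left, vec_smul_left, map_smul]
      change _ • amp (HT H (L2 G)) (U G) (vec (vec (vec x (e g)) (e h)) (e t)) = _
      rw [amp_U_vec]
      rfl
    exact congrArg (fun T => T z) this
  have h3 : comult G (HT H (L2 G)) (kG H g) = op (kG H g) (lam g) := comult_op_lam _ _
  rw [map_mul, map_mul, h1, h2, h3, op_mul, op_mul, one_mul, one_mul]

variable [CompleteSpace H]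

variable (G H) in
/-- The unitary `V = I ⊗ US`. -/
def V : unitary (Bd (HT (HT H (L2 G)) (L2 G))) :=
  ⟨amp H (U G * S G), amp_mem_unitary (mul_mem (U_mem_unitary G) (S_mem_unitary G))⟩

theorem V_vec (x : H) (g h : G) :
    (V G H : Bd (HT (HT H (L2 G)) (L2 G))) (vec (vec x (e g)) (e h)) =
      vec (vec x (e g)) (e (g * h⁻¹)) := amp_US_vec x g h

theorem conjHom_eq_of_mul_eq {X : Type*} [NormedAddCommGroup X] [InnerProductSpace ℂ X]
    [CompleteSpace X] {u : unitary (Bd X)} {x y : Bd X} (h : (u : Bd X) * x = y * u) :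
    conjHom u x = y := by
  rw [conjHom_apply, h, mul_assoc, Unitary.mul_star_self_of_mem u.2, mul_one]

theorem conjHom_V_op_lam (a : Bd H) (s : G) :
    conjHom (V G H) (op (op a (lam s)) 1) = op (op a (lam s)) (lam s) :=
  conjHom_eq_of_mul_eq <| clm_ext_vec_e_e fun x g h => by
    simp [V_vec, mul_assoc]

theorem conjHom_V_kc0 (f : lp (fun _ : G => ℂ) ∞) :
    conjHom (V G H) (kc0 H f) = op 1 (mulOp f) :=
  conjHom_eq_of_mul_eq <| clm_ext_vec_e_e fun x g h => by
    simp [V_vec, kc0_vec, mulOp_e, vec_smul_right]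

theorem conjHom_V_kG (r : G) : conjHom (V G H) (kG H r) = op 1 (rho r) :=
  conjHom_eq_of_mul_eq <| clm_ext_vec_e_e fun x g h => by
    simp [V_vec, kG, mul_assoc]

variable {A : NonUnitalSubalgebra ℂ (Bd H)} {δ : A →ₙₐ[ℂ] minTensor A (CFull G)}

/-- The image under conjugation by `V` of a generator of the double crossed product whose
coefficient `a` is homogeneous. -/
theorem conjHom_V_gen {a : A} {s : G} (ha : (δ a : Bd (HT H (HU G))) = op (a : Bd H) (univ s))
    (f : lp (fun _ : G => ℂ) ∞) (r : G) :
    conjHom (V G H) (kA δ a * kc0 H f * kG H r) =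
      op (dlam δ a : Bd (HT H (L2 G))) (lam s * mulOp f * rho r) := by
  rw [map_mul, map_mul, conjHom_V_kc0, conjHom_V_kG, kA, dlam_apply_of_eq ha, conjHom_V_op_lam,
    op_mul, op_mul, mul_one, mul_one]

theorem conjHom_V_gen_matrixUnit {a : A} {s : G}
    (ha : (δ a : Bd (HT H (HU G))) = op (a : Bd H) (univ s)) (p q : G) :
    conjHom (V G H) (kA δ a * kc0 H (pointFun (s⁻¹ * p)) * kG H (p⁻¹ * s * q)) =
      op (dlam δ a : Bd (HT H (L2 G))) (rankOne ℂ (e p : L2 G) (e q : L2 G)) := by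
  rw [conjHom_V_gen ha, lam_mul_mulOp_mul_rho]

end ConjV

/-! ### Matrices as operators, and the map `δ_λ⁻¹ ⊗ id` -/

section Matrices

open InnerProductSpace

variable {X : Type*} [NormedAddCommGroup X] [InnerProductSpace ℂ X] [CompleteSpace X] {ι : Type*}

theorem rankOne_e_mul [DecidableEq ι] (i j k l : ι) :
    rankOne ℂ (e i : L2 ι) (e j : L2 ι) * rankOne ℂ (e k : L2 ι) (e l : L2 ι) =
      if j = k then rankOne ℂ (e i : L2 ι) (e l : L2 ι) else 0 := by
  rw [ContinuousLinearMap.mul_def, rankOne_comp_rankOne, inner_e_e]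
  split_ifs <;> simp

/-- The embedding of `M_n(𝔹(X))` into `𝔹(X ⊗ ℓ²(ι))`, `M ↦ ∑ M_{ij} ⊗ e_{v i, v j}`, given by an
injection `v` of the index set of the matrices into `ι`. -/
def matrixHom {n : ℕ} (v : Fin n ↪ ι) :
    CStarMatrix (Fin n) (Fin n) (Bd X) →⋆ₙₐ[ℂ] Bd (HT X (L2 ι)) where
  toFun M := ∑ i, ∑ j, opL X X (L2 ι) (L2 ι) (M i j) (rankOne ℂ (e (v i)) (e (v j)))
  map_smul' c M := by simp [Finset.smul_sum, -opL_apply]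
  map_zero' := by simp [-opL_apply]
  map_add' M N := by simp [Finset.sum_add_distrib, -opL_apply]
  map_mul' M N := by
    classical
    have h : ∀ i j k l, opL X X (L2 ι) (L2 ι) (M i j) (rankOne ℂ (e (v i)) (e (v j))) *
        opL X X (L2 ι) (L2 ι) (N k l) (rankOne ℂ (e (v k)) (e (v l))) =
        if j = k then opL X X (L2 ι) (L2 ι) (M i j * N k l)
          (rankOne ℂ (e (v i)) (e (v l))) else 0 := by
      intro i j k l
      rw [opL_apply, opL_apply, op_mul, rankOne_e_mul, v.injective.eq_iff, ← opL_apply]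
      split_ifs
      · rfl
      · exact map_zero _
    have hL : ∀ i l, opL X X (L2 ι) (L2 ι) ((M * N) i l) (rankOne ℂ (e (v i)) (e (v l))) =
        ∑ j, opL X X (L2 ι) (L2 ι) (M i j * N j l) (rankOne ℂ (e (v i)) (e (v l))) := by
      intro i l
      rw [CStarMatrix.mul_apply, map_sum, sum_apply]
    simp only [hL, Finset.sum_mul]
    simp only [Finset.mul_sum, h]
    refine Finset.sum_congr rfl fun i _ => ?_
    rw [Finset.sum_comm]
    refine Finset.sum_congr rfl fun j _ => ?_
    refine Eq.trans ?_ Finset.sum_comm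
    simp
  map_star' M := by
    rw [star_sum, Finset.sum_comm]
    refine Finset.sum_congr rfl fun i _ => ?_
    rw [star_sum]
    refine Finset.sum_congr rfl fun j _ => ?_
    rw [opL_apply, opL_apply, star_op, CStarMatrix.star_apply]
    congr 1
    exact (adjoint_rankOne (e (v i) : L2 ι) (e (v j))).symm

theorem matrixHom_apply {n : ℕ} (v : Fin n ↪ ι) (M : CStarMatrix (Fin n) (Fin n) (Bd X)) :
    matrixHom v M = ∑ i, ∑ j, op (M i j) (rankOne ℂ (e (v i)) (e (v j))) := rfl

theorem matrixHom_injective {n : ℕ} (v : Fin n ↪ ι) :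
    Function.Injective (matrixHom v : CStarMatrix (Fin n) (Fin n) (Bd X) → _) := by
  classical
  have h : ∀ (M : CStarMatrix (Fin n) (Fin n) (Bd X)) i j,
      slice (e (v j)) (e (v i)) (matrixHom v M) = M i j := by
    intro M i j
    rw [matrixHom_apply, map_sum]
    simp only [map_sum, slice_op, rankOne_apply, inner_smul_right, inner_e_e,
      v.injective.eq_iff]
    simp
  intro M N hMN
  ext1 i j
  rw [← h M, ← h N, hMN]

theorem norm_matrixHom {n : ℕ} (v : Fin n ↪ ι) (M : CStarMatrix (Fin n) (Fin n) (Bd X)) :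
    ‖matrixHom v M‖ = ‖M‖ :=
  NonUnitalStarAlgHom.norm_map _ (matrixHom_injective v) M

variable {Y : Type*} [NormedAddCommGroup Y] [InnerProductSpace ℂ Y] [CompleteSpace Y]
  {A : NonUnitalSubalgebra ℂ (Bd X)} {B : NonUnitalSubalgebra ℂ (Bd Y)}

theorem sum_sum_eq_sum_sum_equivFin {E : Type*} [AddCommMonoid E] (F : Finset ι)
    (f : ι → ι → E) :
    ∑ i ∈ F, ∑ j ∈ F, f i j =
      ∑ i : Fin F.card, ∑ j : Fin F.card, f (F.equivFin.symm i) (F.equivFin.symm j) := by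
  have h (f : ι → E) : ∑ i ∈ F, f i = ∑ i : Fin F.card, f (F.equivFin.symm i) := by
    rw [← Finset.sum_coe_sort]
    exact (F.equivFin.symm.sum_comp fun i : F => f i).symm
  rw [h]
  exact Finset.sum_congr rfl fun i _ => h _

/-- For a completely isometric `φ`, the map `φ ⊗ id` is isometric on finite matrices. -/
theorem CompletelyIsometric.norm_sum_op_eq {φ : A →ₙₐ[ℂ] B} (hφ : CompletelyIsometric φ)
    (F : Finset ι) (m : ι → ι → A) :
    ‖∑ i ∈ F, ∑ j ∈ F, op (φ (m i j) : Bd Y) (rankOne ℂ (e i : L2 ι) (e j : L2 ι))‖ =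
      ‖∑ i ∈ F, ∑ j ∈ F, op (m i j : Bd X) (rankOne ℂ (e i : L2 ι) (e j : L2 ι))‖ := by
  let v : Fin F.card ↪ ι := F.equivFin.symm.toEmbedding.trans (Function.Embedding.subtype _)
  have h := hφ F.card fun i j => m (v i) (v j)
  rw [← norm_matrixHom v, ← norm_matrixHom v, matrixHom_apply, matrixHom_apply] at h
  rw [sum_sum_eq_sum_sum_equivFin, sum_sum_eq_sum_sum_equivFin F]
  exact h

/-- The prescriptions `φ(a) ⊗ e_{ij} ↦ a ⊗ e_{ij}`, for `φ : A → B`. -/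
def matrixUnitGraph (ι : Type*) (φ : A →ₙₐ[ℂ] B) : Set (Bd (HT Y (L2 ι)) × Bd (HT X (L2 ι))) :=
  {p | ∃ (a : A) (i j : ι), p = (op (φ a : Bd Y) (rankOne ℂ (e i : L2 ι) (e j : L2 ι)),
    op (a : Bd X) (rankOne ℂ (e i : L2 ι) (e j : L2 ι)))}

theorem CompletelyIsometric.norm_fst_eq_norm_snd {φ : A →ₙₐ[ℂ] B} (hφ : CompletelyIsometric φ)
    {p : Bd (HT Y (L2 ι)) × Bd (HT X (L2 ι))}
    (hp : p ∈ (Submodule.span ℂ (matrixUnitGraph ι φ)).topologicalClosure) : ‖p.1‖ = ‖p.2‖ := by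
  classical
  have hc : IsClosed {p : Bd (HT Y (L2 ι)) × Bd (HT X (L2 ι)) | ‖p.1‖ = ‖p.2‖} :=
    isClosed_eq continuous_fst.norm continuous_snd.norm
  refine hc.closure_subset_iff.2 (fun p hp => ?_) hp
  -- An element of the span is given by a finitely supported family of elements of `A`.
  let unit : ι × ι → A →ₗ[ℂ] Bd (HT Y (L2 ι)) × Bd (HT X (L2 ι)) := fun ij =>
    { toFun := fun a =>
        (opL Y Y (L2 ι) (L2 ι) (φ a) (rankOne ℂ (e ij.1 : L2 ι) (e ij.2 : L2 ι)),
          opL X X (L2 ι) (L2 ι) a (rankOne ℂ (e ij.1 : L2 ι) (e ij.2 : L2 ι)))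
      map_add' := fun a b => by simp [-opL_apply]
      map_smul' := fun c a => by simp [-opL_apply] }
  let L : (ι × ι →₀ A) →ₗ[ℂ] Bd (HT Y (L2 ι)) × Bd (HT X (L2 ι)) := Finsupp.lsum ℂ unit
  have hle : Submodule.span ℂ (matrixUnitGraph ι φ) ≤ LinearMap.range L := by
    refine Submodule.span_le.2 ?_
    rintro _ ⟨a, i, j, rfl⟩
    exact ⟨Finsupp.single (i, j) a, Finsupp.lsum_single _ _ _ _⟩
  obtain ⟨m, rfl⟩ := hle hp
  let F := m.support.image Prod.fst ∪ m.support.image Prod.snd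
  have hL : L m = ∑ i ∈ F, ∑ j ∈ F, unit (i, j) (m (i, j)) := by
    rw [← Finset.sum_product', Finsupp.lsum_apply]
    refine Finset.sum_subset (fun ij hij => ?_) fun ij _ hij => ?_
    · rw [Finset.mem_product]
      exact ⟨Finset.mem_union_left _ (Finset.mem_image_of_mem _ hij),
        Finset.mem_union_right _ (Finset.mem_image_of_mem _ hij)⟩
    · rw [Finsupp.notMem_support_iff.1 hij]
      exact map_zero (unit ij)
  have h := hφ.norm_sum_op_eq F fun i j => m (i, j)
  change ‖(L m).1‖ = ‖(L m).2‖
  rw [hL]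
  simp only [Prod.fst_sum, Prod.snd_sum]
  exact h

/-- For a completely isometric `φ : A → B`, the map `φ⁻¹ ⊗ id` is defined on the whole of
`φ(A) ⊗ 𝕂`: its graph is complete, as it is the graph of an isometry, and hence the domain of this
graph is closed. -/
theorem CompletelyIsometric.exists_extends {φ : A →ₙₐ[ℂ] B} (hφ : CompletelyIsometric φ)
    {x : Bd (HT Y (L2 ι))} (hx : x ∈ (Submodule.span ℂ {T | ∃ (a : A) (i j : ι),
      T = op (φ a : Bd Y) (rankOne ℂ (e i : L2 ι) (e j : L2 ι))}).topologicalClosure) :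
    ∃ y, Extends (matrixUnitGraph ι φ) x y := by
  let N := (Submodule.span ℂ (matrixUnitGraph ι φ)).topologicalClosure
  let fstN : N →L[ℂ] Bd (HT Y (L2 ι)) := ContinuousLinearMap.fst ℂ _ _ ∘L N.subtypeL
  have hanti : AntilipschitzWith 1 fstN := by
    refine AddMonoidHomClass.antilipschitz_of_bound fstN fun p => ?_
    have : ‖(p : Bd (HT Y (L2 ι)) × Bd (HT X (L2 ι)))‖ ≤
        ‖(p : Bd (HT Y (L2 ι)) × Bd (HT X (L2 ι))).1‖ :=
      max_le le_rfl (hφ.norm_fst_eq_norm_snd p.2).symm.le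
    rw [NNReal.coe_one, one_mul]
    exact this
  have : CompleteSpace N :=
    (Submodule.isClosed_topologicalClosure
      (Submodule.span ℂ (matrixUnitGraph ι φ))).completeSpace_coe
  have hclosed : IsClosed (LinearMap.range fstN.toLinearMap : Set (Bd (HT Y (L2 ι)))) :=
    hanti.isClosed_range fstN.uniformContinuous
  obtain ⟨p, hp⟩ := map_mem_of_mem_closure_span hclosed (ContinuousLinearMap.id ℂ _) (by
    rintro _ ⟨a, i, j, rfl⟩
    exact ⟨⟨_, Submodule.le_topologicalClosure _ (Submodule.subset_span ⟨a, i, j, rfl⟩)⟩, rfl⟩) hx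
  refine ⟨(p : Bd (HT Y (L2 ι)) × Bd (HT X (L2 ι))).2, ?_⟩
  have hp' : (p : Bd (HT Y (L2 ι)) × Bd (HT X (L2 ι))).1 = x := hp
  rw [← hp']
  exact p.2

end Matrices

/-! ### The duality isomorphism and the two coactions -/

section Duality

open InnerProductSpace

theorem Extends.mono {E F : Type*} [NormedAddCommGroup E] [NormedSpace ℂ E] [NormedAddCommGroup F]
    [NormedSpace ℂ F] {gen gen' : Set (E × F)} (h : gen ⊆ gen') {x : E} {y : F}
    (hxy : Extends gen x y) : Extends gen' x y :=
  Submodule.topologicalClosure_mono (Submodule.span_mono h) hxy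

theorem Extends.swap {E F : Type*} [NormedAddCommGroup E] [NormedSpace ℂ E] [NormedAddCommGroup F]
    [NormedSpace ℂ F] {gen : Set (E × F)} {gen' : Set (F × E)} (h : ∀ p ∈ gen, p.swap ∈ gen')
    {x : E} {y : F} (hxy : Extends gen x y) : Extends gen' y x :=
  map_mem_of_mem_closure_span (P := (Submodule.span ℂ gen').topologicalClosure)
    (Submodule.isClosed_topologicalClosure _)
    ((ContinuousLinearMap.snd ℂ E F).prod (ContinuousLinearMap.fst ℂ E F))
    (fun p hp => Submodule.le_topologicalClosure _ (Submodule.subset_span (h p hp))) hxy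

section Restrict

variable {X Y : Type*} [NormedAddCommGroup X] [InnerProductSpace ℂ X] [CompleteSpace X]
  [NormedAddCommGroup Y] [InnerProductSpace ℂ Y] [CompleteSpace Y]

/-- The homomorphism between operator algebras given by restriction of a *-homomorphism. -/
def restrictHom (θ : Bd X →⋆ₙₐ[ℂ] Bd Y) (D : NonUnitalSubalgebra ℂ (Bd X))
    (E : NonUnitalSubalgebra ℂ (Bd Y)) (h : ∀ x ∈ D, θ x ∈ E) : D →ₙₐ[ℂ] E where
  toFun x := ⟨θ x, h x x.2⟩
  map_smul' c x := Subtype.ext (map_smul θ c (x : Bd X))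
  map_zero' := Subtype.ext (map_zero θ)
  map_add' x y := Subtype.ext (map_add θ (x : Bd X) y)
  map_mul' x y := Subtype.ext (map_mul θ (x : Bd X) y)

theorem starHom_mem_of_mem_closedAlg {θ : Bd X →⋆ₙₐ[ℂ] Bd Y} (hθ : Function.Injective θ)
    {S : Set (Bd X)} {P : NonUnitalSubalgebra ℂ (Bd Y)} (hP : IsClosed (P : Set (Bd Y)))
    (h : ∀ x ∈ S, θ x ∈ P) {x : Bd X} (hx : x ∈ closedAlg S) : θ x ∈ P := by
  have hc : IsClosed ((P.comap θ : NonUnitalSubalgebra ℂ (Bd X)) : Set (Bd X)) :=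
    hP.preimage (NonUnitalStarAlgHom.isometry θ hθ).continuous
  exact closedAlg_le hc h hx

/-- If the generators of a closed algebra are homogeneous, then so are their products, which span a
dense subspace. -/
theorem dense_homogeneous_restrictHom {G : Type*} [Group G] {S : Set (Bd X)}
    (θ : Bd X →⋆ₙₐ[ℂ] Bd (HT X (L2 G))) (hS : ∀ x ∈ S, ∃ g, θ x = op x (lam g))
    (h : ∀ x ∈ closedAlg S, θ x ∈ minTensor (closedAlg S) (CRed G)) :
    Dense (Submodule.span ℂ (homogeneous lam
      (restrictHom θ (closedAlg S) (minTensor (closedAlg S) (CRed G)) h)) : Set (closedAlg S)) := by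
  refine dense_span_of_subset _ fun x hx => ?_
  have hx' : x ∈ (Submodule.span ℂ
      {y | y ∈ closedAlg S ∧ ∃ g, θ y = op y (lam g)}).topologicalClosure := by
    refine mem_closure_span_of_mem_closedAlg
      (M := {y | y ∈ closedAlg S ∧ ∃ g, θ y = op y (lam g)})
      (fun y hy => ⟨subset_closedAlg S hy, hS y hy⟩) ?_ hx
    rintro y ⟨hy, g, hyg⟩ z ⟨hz, k, hzk⟩
    exact ⟨mul_mem hy hz, g * k, by rw [map_mul, hyg, hzk, op_mul, lam_mul]⟩
  refine Submodule.topologicalClosure_mono (Submodule.span_mono ?_) hx'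
  rintro y ⟨hy, g, hyg⟩
  exact ⟨⟨y, hy⟩, ⟨g, hyg⟩, rfl⟩

theorem dense_homogeneous_of_surjective {G : Type*} [Group G] {D E : NonUnitalSubalgebra ℂ (Bd X)}
    {ε : D →ₙₐ[ℂ] minTensor D (CRed G)} {ε' : E →ₙₐ[ℂ] minTensor E (CRed G)} (φ : D →ₙₐ[ℂ] E)
    (hφ : ∀ d, ‖(φ d : Bd X)‖ ≤ ‖(d : Bd X)‖) (hsurj : Function.Surjective φ)
    (h : ∀ d ∈ homogeneous lam ε, φ d ∈ homogeneous lam ε')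
    (hdense : Dense (Submodule.span ℂ (homogeneous lam ε) : Set D)) :
    Dense (Submodule.span ℂ (homogeneous lam ε') : Set E) := by
  refine dense_span_of_subset _ fun y hy => ?_
  obtain ⟨x, hx⟩ := hsurj ⟨y, hy⟩
  have hx' : contractionL φ hφ x = y := congrArg Subtype.val hx
  rw [← hx']
  exact map_mem_of_dense_span hdense
    (P := (Submodule.span ℂ ((↑) '' homogeneous lam ε' : Set (Bd X))).topologicalClosure)
    (Submodule.isClosed_topologicalClosure _) (contractionL φ hφ)
    (fun d hd => Submodule.le_topologicalClosure _ (Submodule.subset_span ⟨φ d, h d hd, rfl⟩)) x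

theorem starHom_op_one_mul_mem {Z D : Type*} [NormedAddCommGroup Z] [InnerProductSpace ℂ Z]
    [CompleteSpace Z] [AddCommGroup D] [Module ℂ D] [TopologicalSpace D]
    {θ : Bd (HT X Y) →⋆ₙₐ[ℂ] Bd Z} (hθ : Function.Injective θ) {S : Set D}
    (hS : Dense (Submodule.span ℂ S : Set D)) {P : Submodule ℂ (Bd Z)}
    (hP : IsClosed (P : Set (Bd Z))) {φ : D →L[ℂ] Bd X} {R : Bd (HT X Y)}
    (h : ∀ s ∈ S, θ (op (φ s) 1 * R) ∈ P) (d : D) : θ (op (φ d) 1 * R) ∈ P :=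
  map_mem_of_dense_span hS hP
    (starHomL θ hθ ∘L (ContinuousLinearMap.mul ℂ (Bd (HT X Y))).flip R ∘L
      (opL X X Y Y).flip 1 ∘L φ) h d

theorem conjHom_op_one (u : unitary (Bd X)) (x : Bd X) (c : Bd Y) :
    conjHom (⟨op (u : Bd X) 1, op_one_mem_unitary u.2⟩ : unitary (Bd (HT X Y))) (op x c) =
      op (conjHom u x) c := by
  simp only [conjHom_apply, star_op, op_mul, star_one, one_mul, mul_one]

end Restrict

variable {G : Type*} [Group G] {H : Type*} [NormedAddCommGroup H] [InnerProductSpace ℂ H]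
  {A : NonUnitalSubalgebra ℂ (Bd H)} {δ : A →ₙₐ[ℂ] minTensor A (CFull G)}

theorem gen_mem_doubleCrossed (a : A) {f : lp (fun _ : G => ℂ) ∞} (hf : f ∈ c0 G) (g : G) :
    kA δ a * kc0 H f * kG H g ∈ doubleCrossed δ := subset_closedAlg _ ⟨a, f, hf, g, rfl⟩

theorem isClosed_doubleCrossed :
    IsClosed (doubleCrossed δ : Set (Bd (HT (HT H (L2 G)) (L2 G)))) :=
  NonUnitalSubalgebra.isClosed_topologicalClosure _

theorem dlam_mem_dlamRange (a : A) : (dlam δ a : Bd (HT H (L2 G))) ∈ dlamRange δ :=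
  ⟨dlam δ a, ⟨a, rfl⟩, rfl⟩

theorem comult_mem {x : Bd (HT (HT H (L2 G)) (L2 G))} (hx : x ∈ doubleCrossed δ) :
    comult G (HT H (L2 G)) x ∈ minTensor (doubleCrossed δ) (CRed G) := by
  refine starHom_mem_of_mem_closedAlg comult_injective (isClosed_minTensor _ _) ?_ hx
  rintro _ ⟨a, f, hf, g, rfl⟩
  rw [comult_gen]
  exact op_mem_minTensor (gen_mem_doubleCrossed a hf g) (lam_mem_CRed g)

variable (δ) in
/-- The double dual coaction. -/
def doubleDual : doubleCrossed δ →ₙₐ[ℂ] minTensor (doubleCrossed δ) (CRed G) :=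
  restrictHom (comult G (HT H (L2 G))) _ _ fun _ => comult_mem

theorem dense_homogeneous_doubleDual :
    Dense (Submodule.span ℂ (homogeneous lam (doubleDual δ)) : Set (doubleCrossed δ)) :=
  dense_homogeneous_restrictHom _ (by
    rintro _ ⟨a, f, hf, g, rfl⟩
    exact ⟨g, comult_gen δ a f g⟩) _

theorem isReducedCoaction_doubleDual : IsReducedCoaction (doubleCrossed δ) (doubleDual δ) :=
  isReducedCoaction_of_dense_homogeneous _
    (completelyIsometric_of_starHom _ comult_injective _ fun _ => rfl) dense_homogeneous_doubleDual

variable [CompleteSpace H]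

/-- The operators `δ_λ(a) ⊗ e_{pq}` for homogeneous `a` span a dense subspace of `δ_λ(A) ⊗ 𝕂`. -/
theorem mem_stabilization_closure_span (hnormal : IsNormal δ)
    (hdense : Dense (Submodule.span ℂ (homogeneous univ δ) : Set A))
    {x : Bd (HT (HT H (L2 G)) (L2 G))} (hx : x ∈ minTensor (dlamRange δ) (compacts (L2 G))) :
    x ∈ (Submodule.span ℂ {T | ∃ a ∈ homogeneous univ δ, ∃ p q : G,
      T = op (dlam δ a : Bd (HT H (L2 G)))
        (rankOne ℂ (e p : L2 G) (e q : L2 G))}).topologicalClosure := by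
  have h := mem_minTensor_closure_span_of_dense
    (s := {T | ∃ a ∈ homogeneous univ δ, T = (dlam δ a : Bd (HT H (L2 G)))})
    (fun y hy => ?_) (fun k hk => mem_compacts_closure_span hk) hx
  · refine Submodule.topologicalClosure_mono (Submodule.span_mono ?_) h
    rintro _ ⟨_, ⟨a, ha, rfl⟩, _, ⟨p, q, rfl⟩, rfl⟩
    exact ⟨a, ha, p, q, rfl⟩
  · obtain ⟨_, ⟨a, rfl⟩, rfl⟩ := hy
    exact map_mem_of_dense_span hdense
      (P := (Submodule.span ℂ {T | ∃ a ∈ homogeneous univ δ,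
        T = (dlam δ a : Bd (HT H (L2 G)))}).topologicalClosure)
      (Submodule.isClosed_topologicalClosure _)
      (contractionL (dlam δ) fun a => (hnormal.norm_eq a).le)
      (fun b hb => Submodule.le_topologicalClosure _ (Submodule.subset_span ⟨b, hb, rfl⟩)) a

theorem conjHom_V_mem (hnormal : IsNormal δ)
    (hdense : Dense (Submodule.span ℂ (homogeneous univ δ) : Set A))
    {x : Bd (HT (HT H (L2 G)) (L2 G))} (hx : x ∈ doubleCrossed δ) :
    conjHom (V G H) x ∈ minTensor (dlamRange δ) (compacts (L2 G)) := by
  refine starHom_mem_of_mem_closedAlg (conjHom_injective _) (isClosed_minTensor _ _) ?_ hx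
  rintro _ ⟨a, f, hf, g, rfl⟩
  -- The image is continuous and linear in `a`, so `a` may be taken homogeneous.
  rw [mul_assoc]
  refine starHom_op_one_mul_mem (conjHom_injective (V G H)) hdense
    (P := (minTensor (dlamRange δ) (compacts (L2 G))).toSubmodule) (isClosed_minTensor _ _)
    (φ := contractionL (dlam δ) fun a => (hnormal.norm_eq a).le) (fun b hb => ?_) a
  obtain ⟨s, hb⟩ := hb
  change conjHom (V G H) (kA δ b * (kc0 H f * kG H g)) ∈ minTensor (dlamRange δ) (compacts (L2 G))
  rw [← mul_assoc, conjHom_V_gen hb]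
  refine op_mem_minTensor (dlam_mem_dlamRange b) ?_
  have hk : IsCompactOperator (mulOp f) := mulOp_mem_compacts hf
  exact (hk.comp_clm (rho g)).clm_comp (lam s)

theorem conjHom_star_V_mem (hnormal : IsNormal δ)
    (hdense : Dense (Submodule.span ℂ (homogeneous univ δ) : Set A))
    {x : Bd (HT (HT H (L2 G)) (L2 G))} (hx : x ∈ minTensor (dlamRange δ) (compacts (L2 G))) :
    conjHom (star (V G H)) x ∈ doubleCrossed δ := by
  refine map_mem_of_mem_closure_span (P := (doubleCrossed δ).toSubmodule) isClosed_doubleCrossed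
    (starHomL (conjHom (star (V G H))) (conjHom_injective _)) ?_
    (mem_stabilization_closure_span hnormal hdense hx)
  rintro _ ⟨a, ⟨s, ha⟩, p, q, rfl⟩
  rw [← conjHom_V_gen_matrixUnit ha, starHomL_apply, conjHom_star_conjHom]
  exact gen_mem_doubleCrossed a (pointFun_mem_c0 _) _

variable (G H) in
/-- Conjugation by `V ⊗ I`. -/
def conjVOne : Bd (HT (HT (HT H (L2 G)) (L2 G)) (L2 G)) →⋆ₙₐ[ℂ]
    Bd (HT (HT (HT H (L2 G)) (L2 G)) (L2 G)) :=
  conjHom ⟨op (V G H : Bd (HT (HT H (L2 G)) (L2 G))) (1 : Bd (L2 G)), op_one_mem_unitary (V G H).2⟩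

theorem conjVOne_injective : Function.Injective (conjVOne G H) := conjHom_injective _

theorem conjVOne_op (x : Bd (HT (HT H (L2 G)) (L2 G))) (c : Bd (L2 G)) :
    conjVOne G H (op x c) = op (conjHom (V G H) x) c := conjHom_op_one (V G H) x c

theorem extends_conjVOne {D : NonUnitalSubalgebra ℂ (Bd (HT (HT H (L2 G)) (L2 G)))}
    {gen : Set (Bd (HT (HT (HT H (L2 G)) (L2 G)) (L2 G)) ×
      Bd (HT (HT (HT H (L2 G)) (L2 G)) (L2 G)))}
    (hgen : ∀ z ∈ D, ∀ c ∈ CRed G, (op z c, op (conjHom (V G H) z) c) ∈ gen)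
    {y : Bd (HT (HT (HT H (L2 G)) (L2 G)) (L2 G))} (hy : y ∈ minTensor D (CRed G)) :
    Extends gen y (conjVOne G H y) := by
  refine extends_of_mem_closure_span (starHomL (conjVOne G H) conjVOne_injective) ?_
    (mem_minTensor_closure_span hy)
  rintro _ ⟨z, hz, c, hc, rfl⟩
  rw [starHomL_apply, conjVOne_op]
  exact hgen z hz c hc

variable (G H) in
/-- The *-homomorphism `x ↦ (V ⊗ I)(I ⊗ I ⊗ U)(V* x V ⊗ I)(I ⊗ I ⊗ U*)(V* ⊗ I)`, the conjugate
by `V` of the double dual coaction. -/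
def tildeHom : Bd (HT (HT H (L2 G)) (L2 G)) →⋆ₙₐ[ℂ] Bd (HT (HT (HT H (L2 G)) (L2 G)) (L2 G)) :=
  ((conjVOne G H).comp (comult G (HT H (L2 G)))).comp (conjHom (star (V G H)))

theorem tildeHom_injective : Function.Injective (tildeHom G H) := by
  intro x y h
  have h' : conjVOne G H (comult G (HT H (L2 G)) (conjHom (star (V G H)) x)) =
      conjVOne G H (comult G (HT H (L2 G)) (conjHom (star (V G H)) y)) := h
  exact conjHom_injective _ (comult_injective (conjVOne_injective h'))

theorem tildeHom_conjHom_V (x : Bd (HT (HT H (L2 G)) (L2 G))) :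
    tildeHom G H (conjHom (V G H) x) = conjVOne G H (comult G (HT H (L2 G)) x) := by
  change conjVOne G H (comult G _ (conjHom (star (V G H)) (conjHom (V G H) x))) = _
  rw [conjHom_star_conjHom]

theorem tildeHom_matrixUnit {a : A} {s : G}
    (ha : (δ a : Bd (HT H (HU G))) = op (a : Bd H) (univ s)) (p q : G) :
    tildeHom G H (op (dlam δ a : Bd (HT H (L2 G))) (rankOne ℂ (e p : L2 G) (e q : L2 G))) =
      op (op (dlam δ a : Bd (HT H (L2 G))) (rankOne ℂ (e p : L2 G) (e q : L2 G)))
        (lam (p⁻¹ * s * q)) := by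
  rw [← conjHom_V_gen_matrixUnit ha, tildeHom_conjHom_V, comult_gen, conjVOne_op]

theorem tildeHom_mem (hnormal : IsNormal δ)
    (hdense : Dense (Submodule.span ℂ (homogeneous univ δ) : Set A))
    {x : Bd (HT (HT H (L2 G)) (L2 G))} (hx : x ∈ minTensor (dlamRange δ) (compacts (L2 G))) :
    tildeHom G H x ∈ minTensor (minTensor (dlamRange δ) (compacts (L2 G))) (CRed G) := by
  refine starHom_mem_of_mem_closedAlg conjVOne_injective (isClosed_minTensor _ _) ?_
    (comult_mem (conjHom_star_V_mem hnormal hdense hx))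
  rintro _ ⟨z, hz, c, hc, rfl⟩
  rw [conjVOne_op]
  exact op_mem_minTensor (conjHom_V_mem hnormal hdense hz) hc

/-- Conjugation by `I ⊗ U` takes `T ⊗ e_{pq} ⊗ λ_{p⁻¹ s q}` to `T ⊗ e_{pq} ⊗ λ_s`. For `T = δ_λ(a)`
with `a` of degree `s`, the former is the value of `tildeHom`, and the latter that of `δ_λ ⊗ Σ`, at
the operator `δ_λ(a) ⊗ e_{pq} = a ⊗ λ_s ⊗ e_{pq}`. -/
theorem conjHom_ampU_matrixUnit {X : Type*} [NormedAddCommGroup X] [InnerProductSpace ℂ X]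
    [CompleteSpace X] (T : Bd X) (s p q : G) :
    conjHom (ampU G X) (op (op T (rankOne ℂ (e p : L2 G) (e q : L2 G))) (lam (p⁻¹ * s * q))) =
      op (op T (rankOne ℂ (e p : L2 G) (e q : L2 G))) (lam s) := by
  classical
  refine conjHom_eq_of_mul_eq <| clm_ext_vec_e_e fun x k t => ?_
  change amp X (U G) (op _ _ (vec (vec x (e k)) (e t))) =
    op _ _ (amp X (U G) (vec (vec x (e k)) (e t)))
  rw [amp_U_vec]
  simp only [op_vec, rankOne_apply, inner_e_e, lam_e]
  split_ifs with hqk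
  · subst hqk
    rw [one_smul, amp_U_vec]
    simp [mul_assoc]
  · simp

/-- The formula for `δ̃`. As `δ_λ ⊗ id` inverts `δ_λ⁻¹ ⊗ id`, only the existence of the value of
`δ_λ⁻¹ ⊗ id` and the value of `δ_λ ⊗ Σ` at `x` itself are in question; the latter is computed on
the operators `δ_λ(a) ⊗ e_{pq} = a ⊗ λ_s ⊗ e_{pq}` with `a` homogeneous of degree `s`. -/
theorem tildeFormula_tildeHom (hnormal : IsNormal δ)
    (hdense : Dense (Submodule.span ℂ (homogeneous univ δ) : Set A))
    {x : Bd (HT (HT H (L2 G)) (L2 G))} (hx : x ∈ minTensor (dlamRange δ) (compacts (L2 G))) :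
    TildeFormula δ x (tildeHom G H x) := by
  have hspan := mem_stabilization_closure_span hnormal hdense hx
  obtain ⟨x₁, hx₁⟩ := hnormal.exists_extends (x := x)
    (Submodule.topologicalClosure_mono (Submodule.span_mono (by
      rintro _ ⟨a, -, p, q, rfl⟩
      exact ⟨a, p, q, rfl⟩)) hspan)
  refine ⟨x₁, x, conjHom (ampU G (HT H (L2 G))) (tildeHom G H x), hx₁.mono ?_, hx₁.swap ?_,
    ?_, ?_⟩
  · rintro _ ⟨a, i, j, rfl⟩
    exact ⟨a, _, rankOne_mem_compacts _ _, rfl⟩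
  · rintro _ ⟨a, i, j, rfl⟩
    exact ⟨a, _, rankOne_mem_compacts _ _, rfl⟩
  · refine extends_of_mem_closure_span
      (starHomL (conjHom (ampU G (HT H (L2 G)))) (conjHom_injective _) ∘L
        starHomL (tildeHom G H) tildeHom_injective) ?_ hspan
    rintro _ ⟨a, ⟨s, ha⟩, p, q, rfl⟩
    refine ⟨a, lam s, lam_mem_CRed s, _, rankOne_mem_compacts (e p) (e q), ?_⟩
    rw [ContinuousLinearMap.comp_apply, starHomL_apply, starHomL_apply, tildeHom_matrixUnit ha,
      conjHom_ampU_matrixUnit, dlam_apply_of_eq ha]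
  · have h := conjHom_star_conjHom (ampU G (HT H (L2 G))) (tildeHom G H x)
    rw [conjHom_apply (star _), Unitary.coe_star, star_star] at h
    rw [← star_amp]
    exact h.symm

end Duality

end Katayama

end

theorem theorem3p2 {G : Type*} [Group G] {H : Type*} [NormedAddCommGroup H]
    [InnerProductSpace ℂ H] [CompleteSpace H] (A : NonUnitalSubalgebra ℂ (H →L[ℂ] H))
    (hA : IsClosed (A : Set (H →L[ℂ] H))) (δ : A →ₙₐ[ℂ] minTensor A (CFull G))
    (hδ : IsCoaction A δ) (hnormal : IsNormal δ) :
    ∃ (Ψ : doubleCrossed δ →ₙₐ[ℂ] minTensor (dlamRange δ) (compacts (L2 G)))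
      (δhh : doubleCrossed δ →ₙₐ[ℂ] minTensor (doubleCrossed δ) (CRed G))
      (δt : minTensor (dlamRange δ) (compacts (L2 G)) →ₙₐ[ℂ]
        minTensor (minTensor (dlamRange δ) (compacts (L2 G))) (CRed G)),
      -- `Ψ` is a completely isometric isomorphism, given by conjugation by `V = I ⊗ US`
      Function.Bijective Ψ ∧ CompletelyIsometric Ψ ∧
      (∀ x, (Ψ x : Bd (HT (HT H (L2 G)) (L2 G))) =
        amp H (U G * S G) * (x : Bd (HT (HT H (L2 G)) (L2 G))) * star (amp H (U G * S G))) ∧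
      -- the double dual coaction
      IsReducedCoaction (doubleCrossed δ) δhh ∧
      (∀ x, (δhh x : Bd (HT (HT (HT H (L2 G)) (L2 G)) (L2 G))) =
        amp (HT H (L2 G)) (U G) * op (x : Bd (HT (HT H (L2 G)) (L2 G))) (1 : Bd (L2 G)) *
          amp (HT H (L2 G)) (star (U G))) ∧
      -- the reduced coaction `δ̃`
      IsReducedCoaction (minTensor (dlamRange δ) (compacts (L2 G))) δt ∧
      (∀ x : minTensor (dlamRange δ) (compacts (L2 G)), TildeFormula δ (x : Bd (HT (HT H (L2 G)) (L2 G)))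
        (δt x : Bd (HT (HT (HT H (L2 G)) (L2 G)) (L2 G)))) ∧
      -- `Ψ` conjugates the former to the latter: `δ̃ ∘ Ψ = (Ψ ⊗ id) ∘ δhh`
      (∀ x, Extends {p | ∃ (z : doubleCrossed δ), ∃ c ∈ CRed G,
          p = (op (z : Bd (HT (HT H (L2 G)) (L2 G))) c,
            op (Ψ z : Bd (HT (HT H (L2 G)) (L2 G))) c)}
        (δhh x : Bd (HT (HT (HT H (L2 G)) (L2 G)) (L2 G)))
        (δt (Ψ x) : Bd (HT (HT (HT H (L2 G)) (L2 G)) (L2 G)))) := by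
  have hdense := hδ.dense_homogeneous hA
  let Ψ : doubleCrossed δ →ₙₐ[ℂ] minTensor (dlamRange δ) (compacts (L2 G)) :=
    restrictHom (conjHom (V G H)) _ _ fun _ => conjHom_V_mem hnormal hdense
  let δt : minTensor (dlamRange δ) (compacts (L2 G)) →ₙₐ[ℂ]
      minTensor (minTensor (dlamRange δ) (compacts (L2 G))) (CRed G) :=
    restrictHom (tildeHom G H) _ _ fun _ => tildeHom_mem hnormal hdense
  have hΨ : CompletelyIsometric Ψ :=
    completelyIsometric_of_starHom _ (conjHom_injective _) _ fun _ => rfl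
  have hsurj : Function.Surjective Ψ := fun y =>
    ⟨⟨_, conjHom_star_V_mem hnormal hdense y.2⟩, Subtype.ext (conjHom_conjHom_star _ _)⟩
  refine ⟨Ψ, doubleDual δ, δt, ⟨fun x y hxy => ?_, hsurj⟩, hΨ, fun x => rfl,
    isReducedCoaction_doubleDual, fun x => comult_apply _,
    isReducedCoaction_of_dense_homogeneous _
      (completelyIsometric_of_starHom _ tildeHom_injective _ fun _ => rfl) ?_,
    fun x => tildeFormula_tildeHom hnormal hdense x.2, fun x => ?_⟩
  · exact Subtype.ext (conjHom_injective _ (congrArg Subtype.val hxy))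
  · refine dense_homogeneous_of_surjective Ψ (fun a => (hΨ.norm_eq a).le) hsurj ?_
      dense_homogeneous_doubleDual
    rintro d ⟨g, hd⟩
    refine ⟨g, ?_⟩
    have hd' : comult G (HT H (L2 G)) (d : Bd (HT (HT H (L2 G)) (L2 G))) = op d.1 (lam g) := hd
    change tildeHom G H (conjHom (V G H) d) = op (conjHom (V G H) d) (lam g)
    rw [tildeHom_conjHom_V, hd', conjVOne_op]
  · change Extends _ (comult G (HT H (L2 G)) (x : Bd (HT (HT H (L2 G)) (L2 G))))
      (tildeHom G H (conjHom (V G H) x))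
    rw [tildeHom_conjHom_V]
    refine extends_conjVOne ?_ (comult_mem x.2)
    intro z hz c hc
    exact ⟨⟨z, hz⟩, c, hc, rfl⟩
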